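/- \textbf{Proposition 1.} Units $\hbar=c=1$. Let $\Phi$ be a free, minimally coupled real scalar field of mass $m>0$ on the cosmological patch of de Sitter space, $ds^2=-dt^2+e^{2Ht}d\vec x^2$, in the Bunch--Davies vacuum, i.e. the Gaussian state with mode functions $$u_k(t)=\tfrac{\sqrt\pi}{2}\,H\,(-\eta)^{3/2}H^{(1)}_{\nu}(-k\eta),\qquad \eta=-\tfrac{e^{-Ht}}{H},\quad \nu=\sqrt{\tfrac94-\tfrac{m^2}{H^2}} .$$ Compare it with the massless Minkowski vacuum, $u_k(t)=e^{-ikt}/\sqrt{2k}$. In both cases the field $\Phi$ and its momentum $\Pi$ are taken on the flat slice $t=0$ of unit scale factor, where $\Pi=\partial_t\Phi$. A single-mode subsystem $A$ is given by real $f^{(i)},g^{(i)}\in C_c^\infty(\mathbb R^3)$, $i=1,2$, such that the observables $O_i=\int(f^{(i)}\Phi-g^{(i)}\Pi)\,d^3x$ are canonically conjugate, $\int (g^{(1)}f^{(2)}-f^{(1)}g^{(2)})\,d^3x=1$. Let $R$ be half the diameter of the union of the supports of these four functions, $\sigma^{ij}=\langle O_iO_j+O_jO_i\rangle$, $\nu_A=\sqrt{\det\sigma}$,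 and let $$S=\tfrac{\nu_A+1}{2}\log_2\tfrac{\nu_A+1}{2}-\tfrac{\nu_A-1}{2}\log_2\tfrac{\nu_A-1}{2}$$ be the von Neumann entropy of $A$; write $S_{BD}(m,H,A)$ and $S_{M}(A)$ for its values in the two vacua. Call $A$ \emph{saturating} if, for some real $(a,b)\neq(0,0)$, $af^{(1)}+bf^{(2)}=0$ and $f^{(1)},f^{(2)}$ are both real multiples of $\Delta(ag^{(1)}+bg^{(2)})$ (the equality case of the Cauchy--Schwarz inequality $(f|g)_{-1/2}^2\le\|f\|_{-3/2}^2\|g\|_{1/2}^2$ of homogeneous Sobolev products). Then: 1. (Fixed small $m/H$, every mode.) There is $\varepsilon>0$ such that for every $\kappa\in(0,\varepsilon)$ and every $A$ there is $L$ such that $S_{BD}(m,H,A)\ge S_M(A)$ whenever $H>0$, $m/H=\kappa$ and $RH\ge L$. 2. (Jointly, $RH\gg1$ and $mR\ll1$, hence $m/H\ll 1$.) For every $A$ that is not saturating there are $L$ and $\varepsilon>0$ such that $S_{BD}(m,H,A)\ge S_M(A)$ for all $H,m>0$ with $RH\ge L$ and $mR\le\varepsilon$. 3. (Small-mass limit at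 fixed $RH\gg1$, every mode.) For every $A$ there is $L$ such that for every $H>0$ with $RH\ge L$: $\liminf_{m\to0^+}S_{BD}(m,H,A)\ge S_M(A)$, that is, for every $\delta>0$ there is $\varepsilon>0$ such that $S_{BD}(m,H,A)\ge S_M(A)-\delta$ whenever $0<m\le\varepsilon H$. -/

import Mathlib

/-!
Units `ħ = c = 1`.  Physical Cartesian coordinates are used on the flat slice `t = 0`, where the
scale factor is `1`; this identifies slices of the cosmological patch with slices of Minkowski
spacetime.
-/

namespace LocalModes

open scoped FourierTransform ComplexConjugate ContDiff

noncomputable section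

/-- A flat spatial slice. -/
abbrev Space : Type := EuclideanSpace ℝ (Fin 3)

/-- An element `γ = (g, f)` of the classical phase space, smooth and compactly supported.  It
labels the observable `O_γ = ∫ (f Φ - g Π)`. -/
structure PhasePoint where
  g : Space → ℝ
  f : Space → ℝ
  smooth_g : ContDiff ℝ ∞ g
  smooth_f : ContDiff ℝ ∞ f
  compact_g : HasCompactSupport g
  compact_f : HasCompactSupport f

/-- The commutator of two labelled observables: `[O_γ, O_δ] = i * commutatorForm γ δ`, from
`[Φ(x), Π(y)] = i δ(x - y)`. -/
def commutatorForm (γ δ : PhasePoint) : ℝ :=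
  ∫ x : Space, (γ.g x * δ.f x - γ.f x * δ.g x)

/-- A single-mode subsystem, given by a canonically conjugate pair of smeared observables:
`[O_{γ 0}, O_{γ 1}] = i`. -/
structure SingleMode where
  γ : Fin 2 → PhasePoint
  canonical : commutatorForm (γ 0) (γ 1) = 1

/-- The support of a mode: the union of the supports of its smearing functions. -/
def SingleMode.support (A : SingleMode) : Set Space :=
  ⋃ i, (tsupport (A.γ i).g ∪ tsupport (A.γ i).f)

/-- The physical size `R` of a mode: half the diameter of its support. -/
def SingleMode.radius (A : SingleMode) : ℝ := Metric.diam A.support / 2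

/-- A translation-invariant vacuum is given by positive-frequency mode functions `u k t`, through
`Φ(t, x) = ∫ d³k/(2π)³ (a_k u(|k|, t) e^{ikx} + h.c.)`, and, on the slice `t = 0` of unit scale
factor, `Π = ∂ₜΦ`.  This is the coefficient of `O_γ` along the annihilation operators, i.e. its
one-particle vector, as a function of `ξ = k/(2π)` (so that `d³ξ = d³k/(2π)³`). -/
def amplitude (u : ℝ → ℝ → ℂ) (γ : PhasePoint) (ξ : Space) : ℂ :=
  u (2 * Real.pi * ‖ξ‖) 0 * 𝓕 (fun x : Space => (γ.f x : ℂ)) ξ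
    - deriv (u (2 * Real.pi * ‖ξ‖)) 0 * 𝓕 (fun x : Space => (γ.g x : ℂ)) ξ

/-- The vacuum two-point function `⟨O_γ O_δ⟩`. -/
def twoPoint (u : ℝ → ℝ → ℂ) (γ δ : PhasePoint) : ℂ :=
  ∫ ξ : Space, amplitude u γ ξ * conj (amplitude u δ ξ)

/-- The covariance matrix `σ_A`, with entries `⟨O_i O_j + O_j O_i⟩`. -/
def covariance (u : ℝ → ℝ → ℂ) (A : SingleMode) : Matrix (Fin 2) (Fin 2) ℝ :=
  fun i j => (twoPoint u (A.γ i) (A.γ j) + twoPoint u (A.γ j) (A.γ i)).re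

/-- The symplectic invariant `ν_A = √(det σ_A)`. -/
def symplecticInvariant (u : ℝ → ℝ → ℂ) (A : SingleMode) : ℝ :=
  Real.sqrt (covariance u A).det

/-- The von Neumann entropy, in bits, of a one-mode Gaussian state with symplectic invariant
`ν ≥ 1` (with `0 log 0 = 0` at `ν = 1`). -/
def gaussianEntropy (ν : ℝ) : ℝ :=
  (ν + 1) / 2 * Real.logb 2 ((ν + 1) / 2) - (ν - 1) / 2 * Real.logb 2 ((ν - 1) / 2)

/-- The von Neumann entropy of the mode `A` in the vacuum with mode functions `u`. -/
def entropy (u : ℝ → ℝ → ℂ) (A : SingleMode) : ℝ :=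
  gaussianEntropy (symplecticInvariant u A)

/-- Mode functions of the (massless) Minkowski vacuum: `e^{-ikt} / √(2k)`. -/
def minkowskiMode (k t : ℝ) : ℂ :=
  Complex.exp (-(Complex.I * k * t)) / (Real.sqrt (2 * k) : ℂ)

/-- The Hankel function `H_ν^{(1)}(x)` for `x > 0` and real `ν > -1/2`, by Hankel's integral
`√(2/(πx)) e^{i(x - νπ/2 - π/4)} / Γ(ν + 1/2) * ∫₀^∞ e^{-s} s^{ν-1/2} (1 + is/(2x))^{ν-1/2} ds`. -/
def hankelOne (ν x : ℝ) : ℂ :=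
  (Real.sqrt (2 / (Real.pi * x)) : ℂ)
    * Complex.exp (Complex.I * (x - ν * Real.pi / 2 - Real.pi / 4 : ℝ))
    / (Real.Gamma (ν + 1 / 2) : ℂ)
    * ∫ s : ℝ in Set.Ioi 0, ((Real.exp (-s) * s ^ (ν - 1 / 2) : ℝ) : ℂ)
        * (1 + Complex.I * (s / (2 * x) : ℝ)) ^ ((ν - 1 / 2 : ℝ) : ℂ)

/-- The index `√(9/4 - m²/H²)` of the Bunch-Davies mode functions. -/
def bdIndex (m H : ℝ) : ℝ := Real.sqrt (9 / 4 - m ^ 2 / H ^ 2)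

/-- `-η = e^{-Ht}/H`, where `η` is the conformal time of the metric `-dt² + e^{2Ht} dx²`. -/
def negConformalTime (H t : ℝ) : ℝ := Real.exp (-(H * t)) / H

/-- Mode functions of the Bunch-Davies vacuum of a minimally coupled field of mass `m` on the
cosmological patch with Hubble rate `H`: `(√π/2) H (-η)^{3/2} H_ν^{(1)}(-kη)` (the constant
phase of a mode function plays no role). -/
def bunchDaviesMode (m H k t : ℝ) : ℂ :=
  ((Real.sqrt Real.pi / 2 * H * negConformalTime H t ^ (3 / 2 : ℝ) : ℝ) : ℂ)
    * hankelOne (bdIndex m H) (k * negConformalTime H t)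

/-- Entropy of `A` in the Minkowski vacuum. -/
def minkowskiEntropy (A : SingleMode) : ℝ := entropy minkowskiMode A

/-- Entropy of `A` in the Bunch-Davies vacuum. -/
def bunchDaviesEntropy (m H : ℝ) (A : SingleMode) : ℝ := entropy (bunchDaviesMode m H) A

/-- Degenerate modes.  Some nonzero observable of the mode is of pure momentum type, `(g, 0)`, and
all `f`-components of the mode are multiples of `Δ g`.  Since `f̃ ∝ |k|² g̃` is the equality
case of `(f|g)_{-1/2}² ≤ ‖f‖²_{-3/2} ‖g‖²_{1/2}`, these are the modes that saturate the
Cauchy-Schwarz inequality between homogeneous Sobolev products. -/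
def SingleMode.IsSaturating (A : SingleMode) : Prop :=
  ∃ a b : ℝ, (a ≠ 0 ∨ b ≠ 0) ∧ (∀ x, a * (A.γ 0).f x + b * (A.γ 1).f x = 0) ∧
    ∀ i, ∃ c : ℝ, ∀ x, (A.γ i).f x
      = c * Laplacian.laplacian (fun y => a * (A.γ 0).g y + b * (A.γ 1).g y) x

end

end LocalModes

namespace LocalModes

open scoped FourierTransform ComplexConjugate ContDiff Laplacian SchwartzMap
open MeasureTheory Filter Topology Set

noncomputable section

/-! Write `a = ν - 1/2` and let `F`, `G` be the Fourier coefficients of `f`, `g`. Up to a phase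
depending only on `k`, the Bunch-Davies amplitude of an observable is `H^a k^{-(a+1/2)} / (√2
Γ(a+1))` times `K_a(k/H) (F + (1-a) H G) + i a (k²/H) K_{a-1}(k/H) G`, where `K_b` is `hankelKernel
b`. The kernels are continuous up to `0` and do not vanish there, so the behaviour for large `H` can
be read off. The determinant of the covariance matrix is a Gram determinant. By Lagrange's identity
it is a double integral of a nonnegative density (`gramIntegral`), which is insensitive to phases,
is multiplied by the squared determinant under a real change of basis, and is lower semicontinuous
under pointwise convergence by Fatou's lemma. No domination is needed, and the limits need not be
square integrable; this matters for `a → 1`, where an infrared divergence may appear. It therefore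
suffices to find real combinations of the two observables, with coefficients depending on `H`, whose
reduced amplitudes converge pointwise to independent limits. If the coefficient determinant is
`O(H)` and `a` stays above `1/2`, the prefactor `H^{4a}` wins and the Bunch-Davies determinant
diverges (`eventually_le_det_of_limits`). At a fixed ratio `m/H` such combinations exist for every
mode. When `m → 0` as well, so that `(1-a) H² → 0`, they exist unless the mode is saturating. For a
saturating mode at fixed `H` and `a → 1`, the infrared correction to the amplitudes is a shear of
the Minkowski pair. A shear preserves the Gram determinant, so semicontinuity gives the Minkowski
value as a lower bound. Finally the entropy is a continuous increasing function of the square root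
of the determinant. -/

/-! ### Hankel's integral, regularized at the origin. -/

/-- The integrand of `hankelKernel`. -/
def hankelIntegrand (b x s : ℝ) : ℂ :=
  ((Real.exp (-s) * s ^ b : ℝ) : ℂ) * ((x : ℂ) + Complex.I * (s / 2 : ℝ)) ^ (b : ℂ)

/-- The function `∫₀^∞ e^{-s} s^b (x + is/2)^b ds`, which is `x^b` times Hankel's integral for
`ν = b + 1/2` and stays regular at `x = 0`. -/
def hankelKernel (b x : ℝ) : ℂ := ∫ s in Ioi (0 : ℝ), hankelIntegrand b x s

theorem add_I_mul_mem_slitPlane (x : ℝ) {s : ℝ} (hs : 0 < s) :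
    (x : ℂ) + Complex.I * (s / 2 : ℝ) ∈ Complex.slitPlane := by
  right
  simp [hs.ne']

theorem le_norm_add_I_mul (x s : ℝ) :
    s / 2 ≤ ‖(x : ℂ) + Complex.I * (s / 2 : ℝ)‖ := by
  have := Complex.abs_im_le_norm ((x : ℂ) + Complex.I * (s / 2 : ℝ))
  have h : ((x : ℂ) + Complex.I * (s / 2 : ℝ)).im = s / 2 := by
    simp only [Complex.add_im, Complex.ofReal_im, Complex.mul_im, Complex.I_re, Complex.I_im,
      Complex.ofReal_re]
    ring
  rw [h] at this
  exact (le_abs_self _).trans this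

theorem norm_add_I_mul_le {x s : ℝ} (hx : 0 ≤ x) (hs : 0 < s) :
    ‖(x : ℂ) + Complex.I * (s / 2 : ℝ)‖ ≤ x + s / 2 := by
  refine (norm_add_le _ _).trans (le_of_eq ?_)
  rw [norm_mul, Complex.norm_I, one_mul, Complex.norm_real, Complex.norm_real, Real.norm_eq_abs,
    Real.norm_eq_abs, abs_of_nonneg hx, abs_of_pos (by positivity)]

theorem norm_hankelIntegrand (b x : ℝ) {s : ℝ} (hs : 0 < s) :
    ‖hankelIntegrand b x s‖
      = Real.exp (-s) * (s * ‖(x : ℂ) + Complex.I * (s / 2 : ℝ)‖) ^ b := by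
  rw [hankelIntegrand, norm_mul, Complex.norm_cpow_real, Complex.norm_real, Real.norm_eq_abs,
    abs_of_nonneg (by positivity), Real.mul_rpow hs.le (norm_nonneg _), mul_assoc]

/-- A function dominating `hankelIntegrand b x` for `-β ≤ b ≤ 1` and `0 ≤ x ≤ X`. -/
def hankelBound (β X s : ℝ) : ℝ :=
  2 ^ β * (Real.exp (-s) * s ^ (1 - 2 * β - 1)) + X * (Real.exp (-s) * s ^ ((2 : ℝ) - 1))
    + 1 / 2 * (Real.exp (-s) * s ^ ((3 : ℝ) - 1))

/-- The singular term is `s^{-2β}`, integrable at `0` because `β < 1/2`. This is the source of the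
condition `-1/2 < b` on the index. -/
theorem integrableOn_hankelBound {β : ℝ} (hβ : β < 1 / 2) (X : ℝ) :
    IntegrableOn (hankelBound β X) (Ioi 0) :=
  (((Real.GammaIntegral_convergent (by linarith)).const_mul _).add
    ((Real.GammaIntegral_convergent (by norm_num)).const_mul _)).add
    ((Real.GammaIntegral_convergent (by norm_num)).const_mul _)

theorem rpow_le_rpow_neg_add {y b β : ℝ} (hy : 0 < y) (hβ : -β ≤ b) (hb : b ≤ 1) :
    y ^ b ≤ y ^ (-β) + y := by
  rcases le_total y 1 with h | h
  · have := Real.rpow_le_rpow_of_exponent_ge hy h hβ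
    linarith
  · have := Real.rpow_le_rpow_of_exponent_le h hb
    rw [Real.rpow_one] at this
    have := Real.rpow_nonneg hy.le (-β)
    linarith

/-- The product `s |x + is/2|` lies between `s²/2` and `X s + s²/2`. The lower bound controls its
negative powers, the upper bound its positive ones. -/
theorem norm_hankelIntegrand_le {b x β X s : ℝ} (hβ0 : 0 ≤ β) (hβ : -β ≤ b) (hb : b ≤ 1)
    (hx : 0 ≤ x) (hX : x ≤ X) (hs : 0 < s) : ‖hankelIntegrand b x s‖ ≤ hankelBound β X s := by
  rw [norm_hankelIntegrand b x hs]
  have h1 := le_norm_add_I_mul x s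
  have h2 := norm_add_I_mul_le hx hs
  set B := ‖(x : ℂ) + Complex.I * (s / 2 : ℝ)‖
  have hB : 0 < B := lt_of_lt_of_le (by positivity) h1
  have h3 : (s * B) ^ (-β) ≤ 2 ^ β * s ^ (-2 * β) := by
    have : (s * B) ^ (-β) ≤ (s ^ (2 : ℝ) / 2) ^ (-β) := by
      refine Real.rpow_le_rpow_of_nonpos (by positivity) ?_ (by linarith)
      rw [Real.rpow_two]
      nlinarith
    refine this.trans (le_of_eq ?_)
    rw [Real.div_rpow (by positivity) (by norm_num), ← Real.rpow_mul hs.le, Real.rpow_neg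
      (by norm_num : (0 : ℝ) ≤ 2), div_inv_eq_mul, mul_comm]
    ring_nf
  have h4 : s * B ≤ X * s + 1 / 2 * s ^ (2 : ℝ) := by
    rw [Real.rpow_two]
    nlinarith
  have h5 := rpow_le_rpow_neg_add (mul_pos hs hB) hβ hb
  calc Real.exp (-s) * (s * B) ^ b
      ≤ Real.exp (-s) * (2 ^ β * s ^ (-2 * β) + (X * s + 1 / 2 * s ^ (2 : ℝ))) := by
        gcongr
        linarith
    _ = hankelBound β X s := by
        rw [hankelBound, show (1 - 2 * β - 1) = -2 * β by ring, show (2 : ℝ) - 1 = 1 by norm_num,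
          show (3 : ℝ) - 1 = 2 by norm_num, Real.rpow_one]
        ring

theorem continuousOn_hankelFactor (b c x : ℝ) :
    ContinuousOn (fun s : ℝ => ((Real.exp (-s) * s ^ b : ℝ) : ℂ)
      * ((x : ℂ) + Complex.I * (s / 2 : ℝ)) ^ (c : ℂ)) (Ioi 0) := by
  intro s hs
  have hs' : (0 : ℝ) < s := hs
  refine ContinuousAt.continuousWithinAt (ContinuousAt.mul ?_ ?_)
  · refine Complex.continuous_ofReal.continuousAt.comp (ContinuousAt.mul (by fun_prop) ?_)
    exact Real.continuousAt_rpow_const _ _ (Or.inl hs'.ne')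
  · refine ContinuousAt.cpow (by fun_prop) continuousAt_const (add_I_mul_mem_slitPlane x hs')

theorem aestronglyMeasurable_hankelIntegrand (b x : ℝ) :
    AEStronglyMeasurable (hankelIntegrand b x) (volume.restrict (Ioi 0)) :=
  (continuousOn_hankelFactor b b x).aestronglyMeasurable measurableSet_Ioi

theorem integrableOn_hankelIntegrand {b x : ℝ} (hb : -1 / 2 < b) (hb1 : b ≤ 1) (hx : 0 ≤ x) :
    IntegrableOn (hankelIntegrand b x) (Ioi 0) := by
  have hβ : max 0 (-b) < 1 / 2 := by
    rw [max_lt_iff]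
    constructor <;> linarith
  refine (integrableOn_hankelBound hβ x).mono' (aestronglyMeasurable_hankelIntegrand b x) ?_
  filter_upwards [ae_restrict_mem measurableSet_Ioi] with s hs
  exact norm_hankelIntegrand_le (le_max_left _ _) (by linarith [le_max_right 0 (-b)]) hb1 hx
    le_rfl hs

/-- Convergence is joint because the index moves with the mass while `k/H` moves with `H`. The limit
`x₀ = 0` is allowed since `x + is/2` stays off the branch cut for `s > 0`. -/
theorem tendsto_hankelKernel {ι : Type*} {l : Filter ι} [l.IsCountablyGenerated] {b x : ι → ℝ}
    {b₀ x₀ : ℝ} (hb₀ : -1 / 2 < b₀) (hb : Tendsto b l (𝓝 b₀)) (hb1 : ∀ᶠ i in l, b i ≤ 1)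
    (hx : Tendsto x l (𝓝 x₀)) (hx0 : ∀ᶠ i in l, 0 ≤ x i) :
    Tendsto (fun i => hankelKernel (b i) (x i)) l (𝓝 (hankelKernel b₀ x₀)) := by
  -- The second entry is the midpoint of `-b₀` and `1/2`, which leaves room for the nearby indices
  -- `b i`.
  set β := max 0 ((1 / 2 - b₀) / 2)
  have hβ : β < 1 / 2 := by
    rw [max_lt_iff]
    constructor <;> linarith
  have hβb : -β < b₀ := by linarith [le_max_right 0 ((1 / 2 - b₀) / 2)]
  refine tendsto_integral_filter_of_dominated_convergence (hankelBound β (x₀ + 1))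
    (Eventually.of_forall fun i => aestronglyMeasurable_hankelIntegrand _ _) ?_
    (integrableOn_hankelBound hβ _) ?_
  · filter_upwards [hb1, hx0, Tendsto.eventually_const_le hβb hb,
      Tendsto.eventually_le_const (lt_add_one x₀) hx] with i h1 h2 h3 h4
    filter_upwards [ae_restrict_mem measurableSet_Ioi] with s hs
    exact norm_hankelIntegrand_le (le_max_left _ _) h3 h1 h2 h4 hs
  · filter_upwards [ae_restrict_mem measurableSet_Ioi] with s hs
    have hs' : (0 : ℝ) < s := hs
    refine Tendsto.mul ?_ ?_
    · exact (Complex.continuous_ofReal.tendsto _).comp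
        (tendsto_const_nhds.mul (tendsto_const_nhds.rpow hb (Or.inl hs'.ne')))
    · refine Tendsto.cpow ?_ ((Complex.continuous_ofReal.tendsto _).comp hb)
        (add_I_mul_mem_slitPlane x₀ hs')
      exact ((Complex.continuous_ofReal.tendsto _).comp hx).add tendsto_const_nhds

theorem continuousOn_hankelKernel {b : ℝ} (hb : -1 / 2 < b) (hb1 : b ≤ 1) :
    ContinuousOn (hankelKernel b) (Ici 0) := fun _ _ =>
  tendsto_hankelKernel hb tendsto_const_nhds (Eventually.of_forall fun _ => hb1)
    (tendsto_id.mono_left nhdsWithin_le_nhds) (by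
      filter_upwards [self_mem_nhdsWithin] with y hy using hy)

/-- The kernel grows at most linearly. -/
theorem exists_norm_hankelKernel_le {b : ℝ} (hb : -1 / 2 < b) (hb1 : b ≤ 1) :
    ∃ C, 0 ≤ C ∧ ∀ x, 0 ≤ x → ‖hankelKernel b x‖ ≤ C * (1 + x) := by
  set β := max 0 (-b)
  have hβ : β < 1 / 2 := by
    rw [max_lt_iff]
    constructor <;> linarith
  set C₀ := ∫ s in Ioi (0 : ℝ), hankelBound β 0 s
  set C₁ := ∫ s in Ioi (0 : ℝ), Real.exp (-s) * s ^ ((2 : ℝ) - 1)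
  have hC₁ : 0 ≤ C₁ := setIntegral_nonneg measurableSet_Ioi fun s hs => by
    have : (0 : ℝ) < s := hs
    positivity
  have hC₀ : 0 ≤ C₀ := setIntegral_nonneg measurableSet_Ioi fun s hs => by
    have : (0 : ℝ) < s := hs
    unfold hankelBound
    positivity
  -- The dominating function is affine in its cut-off, and the cut-off may be taken equal to `x`.
  have key : ∀ x, ∫ s in Ioi (0 : ℝ), hankelBound β x s = C₀ + x * C₁ := by
    intro x
    rw [← integral_const_mul, ← integral_add (integrableOn_hankelBound hβ 0)
      ((Real.GammaIntegral_convergent (by norm_num)).const_mul _)]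
    refine integral_congr_ae (Eventually.of_forall fun s => ?_)
    simp only [hankelBound]
    ring
  refine ⟨C₀ + C₁, by positivity, fun x hx => ?_⟩
  have : ‖hankelKernel b x‖ ≤ C₀ + x * C₁ := by
    rw [← key]
    refine norm_integral_le_of_norm_le (integrableOn_hankelBound hβ x) ?_
    filter_upwards [ae_restrict_mem measurableSet_Ioi] with s hs
    exact norm_hankelIntegrand_le (le_max_left _ _) (by linarith [le_max_right 0 (-b)]) hb1 hx
      le_rfl hs
  nlinarith

theorem integral_exp_neg_Ioi_ofReal :
    ∫ s in Ioi (0 : ℝ), ((Real.exp (-s) : ℝ) : ℂ) = 1 := by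
  rw [integral_complex_ofReal, integral_exp_neg_Ioi]
  simp

theorem hankelKernel_zero_left (x : ℝ) : hankelKernel 0 x = 1 := by
  simp only [hankelKernel, hankelIntegrand, Real.rpow_zero, mul_one, Complex.ofReal_zero,
    Complex.cpow_zero]
  exact integral_exp_neg_Ioi_ofReal

theorem hankelKernel_one_left (x : ℝ) : hankelKernel 1 x = x + Complex.I := by
  have h2 : ∫ s in Ioi (0 : ℝ), Real.exp (-s) * s ^ ((2 : ℝ) - 1) = 1 := by
    rw [← Real.Gamma_eq_integral (by norm_num), Real.Gamma_two]
  have h3 : ∫ s in Ioi (0 : ℝ), Real.exp (-s) * s ^ ((3 : ℝ) - 1) = 2 := by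
    rw [← Real.Gamma_eq_integral (by norm_num), show (3 : ℝ) = 2 + 1 by norm_num,
      Real.Gamma_add_one (by norm_num), Real.Gamma_two]
    norm_num
  have e : hankelKernel 1 x = ∫ s in Ioi (0 : ℝ),
      ((x : ℂ) * ((Real.exp (-s) * s ^ ((2 : ℝ) - 1) : ℝ) : ℂ)
        + Complex.I / 2 * ((Real.exp (-s) * s ^ ((3 : ℝ) - 1) : ℝ) : ℂ)) := by
    refine setIntegral_congr_fun measurableSet_Ioi fun s _ => ?_
    simp only [hankelIntegrand, show (2 : ℝ) - 1 = 1 by norm_num, show (3 : ℝ) - 1 = 2 by norm_num,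
      Real.rpow_one, Real.rpow_two, Complex.ofReal_one, Complex.cpow_one]
    push_cast
    ring
  rw [e, integral_add, integral_const_mul, integral_const_mul, integral_complex_ofReal,
    integral_complex_ofReal, h2, h3]
  · push_cast
    ring
  · exact (Integrable.ofReal (Real.GammaIntegral_convergent (by norm_num))).const_mul _
  · exact (Integrable.ofReal (Real.GammaIntegral_convergent (by norm_num))).const_mul _

theorem ofReal_mul_cpow_ofReal {x : ℝ} (hx : 0 < x) {z : ℂ} (hz : z ≠ 0) (c : ℝ) :
    ((x : ℂ) * z) ^ (c : ℂ) = ((x ^ c : ℝ) : ℂ) * z ^ (c : ℂ) := by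
  have hx' : (x : ℂ) ≠ 0 := by exact_mod_cast hx.ne'
  rw [Complex.cpow_def_of_ne_zero (mul_ne_zero hx' hz), Complex.log_ofReal_mul hx hz, add_mul,
    Complex.exp_add, Complex.cpow_def_of_ne_zero hz, Real.rpow_def_of_pos hx]
  push_cast
  rfl

/-- At `x = 0` the integral is a Gamma integral, with value `(i/2)^b Γ(2b + 1)`. -/
theorem hankelKernel_zero_right_ne_zero {b : ℝ} (hb : -1 / 2 < b) : hankelKernel b 0 ≠ 0 := by
  have e : hankelKernel b 0 = ∫ s in Ioi (0 : ℝ),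
      (((Real.exp (-s) * s ^ ((2 * b + 1) - 1) : ℝ) : ℂ)
        * (((1 / 2 : ℝ) : ℂ) * Complex.I) ^ (b : ℂ)) := by
    refine setIntegral_congr_fun measurableSet_Ioi fun s hs => ?_
    have hs' : (0 : ℝ) < s := hs
    simp only [hankelIntegrand]
    rw [show ((0 : ℝ) : ℂ) + Complex.I * (s / 2 : ℝ) = (s : ℂ) * (((1 / 2 : ℝ) : ℂ) * Complex.I)
      by push_cast; ring, ofReal_mul_cpow_ofReal hs' (by simp), ← mul_assoc,
      ← Complex.ofReal_mul, mul_assoc, ← Real.rpow_add hs']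
    ring_nf
  rw [e, integral_mul_const, integral_complex_ofReal, ← Real.Gamma_eq_integral (by linarith)]
  refine mul_ne_zero ?_ ?_
  · exact_mod_cast (Real.Gamma_pos_of_pos (by linarith)).ne'
  · rw [Complex.cpow_ne_zero_iff]
    left
    simp

/-- Hankel's integral in terms of `hankelKernel`. -/
theorem hankelOne_eq {ν x : ℝ} (hx : 0 < x) :
    hankelOne ν x = (Real.sqrt (2 / Real.pi) : ℂ)
      * Complex.exp (-(Complex.I * (ν * Real.pi / 2 + Real.pi / 4 : ℝ)))
      / (Real.Gamma (ν + 1 / 2) : ℂ) * ((x ^ (-ν) : ℝ) : ℂ) * Complex.exp (Complex.I * x)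
      * hankelKernel (ν - 1 / 2) x := by
  have e : ∫ s : ℝ in Ioi 0, ((Real.exp (-s) * s ^ (ν - 1 / 2) : ℝ) : ℂ)
        * (1 + Complex.I * (s / (2 * x) : ℝ)) ^ ((ν - 1 / 2 : ℝ) : ℂ)
      = ((x ^ (-(ν - 1 / 2)) : ℝ) : ℂ) * hankelKernel (ν - 1 / 2) x := by
    rw [hankelKernel, ← integral_const_mul]
    refine setIntegral_congr_fun measurableSet_Ioi fun s hs => ?_
    have hs' : (0 : ℝ) < s := hs
    have hx' : (x : ℂ) ≠ 0 := by exact_mod_cast hx.ne'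
    have h0 : (1 + Complex.I * (s / (2 * x) : ℝ)) ≠ 0 := by
      intro h
      have := congrArg Complex.re h
      simp only [Complex.add_re, Complex.one_re, Complex.re_mul_ofReal, Complex.I_re, zero_mul,
        add_zero, Complex.zero_re, one_ne_zero] at this
    have h1 : (x : ℂ) + Complex.I * (s / 2 : ℝ)
        = (x : ℂ) * (1 + Complex.I * (s / (2 * x) : ℝ)) := by
      push_cast
      field_simp
    simp only [hankelIntegrand]
    rw [h1, ofReal_mul_cpow_ofReal hx h0, Real.rpow_neg hx.le]
    have h2 : ((x ^ (ν - 1 / 2) : ℝ) : ℂ) ≠ 0 := by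
      exact_mod_cast (Real.rpow_pos_of_pos hx _).ne'
    rw [Complex.ofReal_inv, mul_left_comm (((x ^ (ν - 1 / 2) : ℝ) : ℂ)⁻¹), inv_mul_cancel_left₀ h2]
  have h3 : Real.sqrt (2 / (Real.pi * x)) = Real.sqrt (2 / Real.pi) * x ^ (-(1 / 2) : ℝ) := by
    rw [show 2 / (Real.pi * x) = 2 / Real.pi * x⁻¹ by field_simp, Real.sqrt_mul (by positivity),
      Real.sqrt_inv, Real.sqrt_eq_rpow x, Real.rpow_neg hx.le]
  have h4 : x ^ (-ν) = x ^ (-(1 / 2) : ℝ) * x ^ (-(ν - 1 / 2)) := by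
    rw [← Real.rpow_add hx]
    ring_nf
  have h5 : Complex.exp (Complex.I * (x - ν * Real.pi / 2 - Real.pi / 4 : ℝ))
      = Complex.exp (-(Complex.I * (ν * Real.pi / 2 + Real.pi / 4 : ℝ)))
        * Complex.exp (Complex.I * x) := by
    rw [← Complex.exp_add]
    push_cast
    ring_nf
  rw [hankelOne, e, h3, h4, h5]
  push_cast
  ring

/-! ### Derivative and recurrence of the kernel. -/

/-- The `x`-derivative of `hankelIntegrand`. -/
def hankelDerivIntegrand (a x s : ℝ) : ℂ :=
  ((Real.exp (-s) * s ^ a : ℝ) : ℂ)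
    * (a * ((x : ℂ) + Complex.I * (s / 2 : ℝ)) ^ ((a - 1 : ℝ) : ℂ))

theorem hasDerivAt_cpow_add_I_mul_left (c x : ℝ) {s : ℝ} (hs : 0 < s) :
    HasDerivAt (fun y : ℝ => ((y : ℂ) + Complex.I * (s / 2 : ℝ)) ^ (c : ℂ))
      (c * ((x : ℂ) + Complex.I * (s / 2 : ℝ)) ^ ((c - 1 : ℝ) : ℂ)) x := by
  have h := (((hasDerivAt_id (x : ℂ)).add_const (Complex.I * (s / 2 : ℝ))).cpow_const (c := (c : ℂ))
    (add_I_mul_mem_slitPlane x hs)).comp_ofReal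
  simpa using h

theorem hasDerivAt_cpow_add_I_mul_right (c x : ℝ) {s : ℝ} (hs : 0 < s) :
    HasDerivAt (fun t : ℝ => ((x : ℂ) + Complex.I * (t / 2 : ℝ)) ^ (c : ℂ))
      (c * ((x : ℂ) + Complex.I * (s / 2 : ℝ)) ^ ((c - 1 : ℝ) : ℂ) * (Complex.I / 2)) s := by
  have h0 : HasDerivAt (fun z : ℂ => (x : ℂ) + Complex.I * (z / 2)) (Complex.I / 2) (s : ℂ) := by
    simpa [div_eq_mul_inv] using
      (((hasDerivAt_id (s : ℂ)).div_const 2).const_mul Complex.I).const_add (x : ℂ)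
  have h1 := add_I_mul_mem_slitPlane x hs
  push_cast at h1
  have h := (h0.cpow_const (c := (c : ℂ)) h1).comp_ofReal
  push_cast
  exact h

/-- As `a - 1 ≤ 0`, the lower bound `|x + is/2| ≥ s/2` is the useful one. The result is uniform in
`x` and justifies differentiating under the integral sign. -/
theorem norm_hankelDerivIntegrand_le {a : ℝ} (ha : 0 < a) (ha1 : a ≤ 1) (x : ℝ) {s : ℝ}
    (hs : 0 < s) :
    ‖hankelDerivIntegrand a x s‖
      ≤ a * (1 / 2) ^ (a - 1) * (Real.exp (-s) * s ^ (2 * a - 1)) := by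
  have h1 := le_norm_add_I_mul x s
  rw [hankelDerivIntegrand, norm_mul, norm_mul, Complex.norm_cpow_real, Complex.norm_real,
    Complex.norm_real, Real.norm_eq_abs, Real.norm_eq_abs, abs_of_pos ha,
    abs_of_nonneg (by positivity)]
  have h2 := Real.rpow_le_rpow_of_nonpos (z := a - 1) (by positivity) h1 (by linarith)
  have h3 : s ^ a * (s / 2) ^ (a - 1) = (1 / 2) ^ (a - 1) * s ^ (2 * a - 1) := by
    rw [show s / 2 = s * (1 / 2) by ring, Real.mul_rpow hs.le (by norm_num), ← mul_assoc,
      ← Real.rpow_add hs, mul_comm]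
    ring_nf
  calc _ ≤ Real.exp (-s) * s ^ a * (a * (s / 2) ^ (a - 1)) := by gcongr
    _ = a * Real.exp (-s) * (s ^ a * (s / 2) ^ (a - 1)) := by ring
    _ = _ := by rw [h3]; ring

theorem aestronglyMeasurable_hankelDerivIntegrand (a x : ℝ) :
    AEStronglyMeasurable (hankelDerivIntegrand a x) (volume.restrict (Ioi 0)) := by
  have := ((continuousOn_hankelFactor a (a - 1) x).const_mul (a : ℂ)).aestronglyMeasurable
    (μ := volume) measurableSet_Ioi
  refine this.congr (Eventually.of_forall fun s => ?_)
  simp only [hankelDerivIntegrand]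
  ring

theorem integrableOn_hankelDerivIntegrand {a : ℝ} (ha : 0 < a) (ha1 : a ≤ 1) (x : ℝ) :
    IntegrableOn (hankelDerivIntegrand a x) (Ioi 0) := by
  refine ((Real.GammaIntegral_convergent (s := 2 * a) (by linarith)).const_mul
    (a * (1 / 2) ^ (a - 1))).mono' (aestronglyMeasurable_hankelDerivIntegrand a x) ?_
  filter_upwards [ae_restrict_mem measurableSet_Ioi] with s hs
  exact norm_hankelDerivIntegrand_le ha ha1 x hs

theorem hasDerivAt_hankelKernel_integral {a x : ℝ} (ha : 0 < a) (ha1 : a ≤ 1) (hx : 0 < x) :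
    HasDerivAt (hankelKernel a) (∫ s in Ioi (0 : ℝ), hankelDerivIntegrand a x s) x := by
  refine (hasDerivAt_integral_of_dominated_loc_of_deriv_le (s := univ)
    (F := fun y s => hankelIntegrand a y s) (F' := fun y s => hankelDerivIntegrand a y s)
    (bound := fun s => a * (1 / 2) ^ (a - 1) * (Real.exp (-s) * s ^ (2 * a - 1)))
    univ_mem ?_ ?_ ?_ ?_ ?_ ?_).2
  · exact Eventually.of_forall fun y => aestronglyMeasurable_hankelIntegrand a y
  · exact integrableOn_hankelIntegrand (by linarith) ha1 hx.le
  · exact aestronglyMeasurable_hankelDerivIntegrand a x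
  · filter_upwards [ae_restrict_mem measurableSet_Ioi] with s hs y _
    exact norm_hankelDerivIntegrand_le ha ha1 y hs
  · exact (Real.GammaIntegral_convergent (s := 2 * a) (by linarith)).const_mul _
  · filter_upwards [ae_restrict_mem measurableSet_Ioi] with s hs y _
    exact (hasDerivAt_cpow_add_I_mul_left a y hs).const_mul _

/-- The two power factors together contribute `a s^{a-1} (x + is/2)^{a-1} (x + is)`. The summand `x`
yields the index `a - 1` and the summand `is` the `x`-derivative, so integration over `s` gives the
recurrence. -/
theorem hasDerivAt_hankelIntegrand (a x : ℝ) {s : ℝ} (hs : 0 < s) :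
    HasDerivAt (hankelIntegrand a x)
      (Complex.I * (Complex.I * hankelIntegrand a x s + hankelDerivIntegrand a x s
        - Complex.I * a * x * hankelIntegrand (a - 1) x s)) s := by
  have h1 : HasDerivAt (fun t : ℝ => Real.exp (-t) * t ^ a)
      (-Real.exp (-s) * s ^ a + Real.exp (-s) * (a * s ^ (a - 1))) s := by
    have := ((hasDerivAt_neg s).exp).mul (Real.hasDerivAt_rpow_const (p := a) (Or.inl hs.ne'))
    refine this.congr_deriv ?_
    ring
  have h2 := h1.ofReal_comp.mul (hasDerivAt_cpow_add_I_mul_right a x hs)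
  refine h2.congr_deriv ?_
  have hB := Complex.slitPlane_ne_zero (add_I_mul_mem_slitPlane x hs)
  have hs' : (s : ℂ) ≠ 0 := by exact_mod_cast hs.ne'
  have h3 : ((s ^ a : ℝ) : ℂ) = ((s ^ (a - 1) : ℝ) : ℂ) * s := by
    rw [Real.rpow_sub_one hs.ne']
    push_cast
    field_simp
  have h4 : ((x : ℂ) + Complex.I * (s / 2 : ℝ)) ^ (a : ℂ)
      = ((x : ℂ) + Complex.I * (s / 2 : ℝ)) ^ ((a - 1 : ℝ) : ℂ)
        * ((x : ℂ) + Complex.I * (s / 2 : ℝ)) := by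
    rw [Complex.ofReal_sub, Complex.ofReal_one, Complex.cpow_sub _ _ hB, Complex.cpow_one]
    field_simp
  simp only [hankelIntegrand, hankelDerivIntegrand]
  push_cast at *
  rw [h3, h4]
  generalize ((x : ℂ) + Complex.I * (s / 2)) ^ ((a : ℂ) - 1) = B
  generalize ((s ^ (a - 1) : ℝ) : ℂ) = T
  generalize Complex.exp (-(s : ℂ)) = E
  ring_nf
  simp only [Complex.I_sq, show Complex.I ^ 3 = -Complex.I by rw [pow_succ, Complex.I_sq]; ring]
  ring

theorem tendsto_hankelIntegrand_zero {a x : ℝ} (ha : 0 < a) (hx : 0 ≤ x) :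
    Tendsto (hankelIntegrand a x) (𝓝[>] 0) (𝓝 0) := by
  have h1 : Tendsto (fun s : ℝ => Real.exp (-s) * (s * (x + s / 2)) ^ a) (𝓝[>] 0) (𝓝 0) := by
    have : ContinuousAt (fun s : ℝ => Real.exp (-s) * (s * (x + s / 2)) ^ a) 0 :=
      ContinuousAt.mul (by fun_prop) (ContinuousAt.rpow_const (by fun_prop) (Or.inr ha.le))
    have h := this.tendsto
    simp only [zero_mul, Real.zero_rpow ha.ne', mul_zero] at h
    exact h.mono_left nhdsWithin_le_nhds
  refine squeeze_zero_norm' ?_ h1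
  filter_upwards [self_mem_nhdsWithin] with s hs
  have hs' : (0 : ℝ) < s := hs
  rw [norm_hankelIntegrand a x hs']
  have := norm_add_I_mul_le hx hs'
  gcongr

/-- The recurrence `(x^ν H_ν)' = x^ν H_{ν-1}`. -/
theorem I_mul_hankelKernel_add {a x : ℝ} (ha : 1 / 2 < a) (ha1 : a ≤ 1) (hx : 0 < x) :
    Complex.I * hankelKernel a x + ∫ s in Ioi (0 : ℝ), hankelDerivIntegrand a x s
      = Complex.I * a * x * hankelKernel (a - 1) x := by
  have i1 := (integrableOn_hankelIntegrand (b := a) (by linarith) ha1 hx.le).const_mul Complex.I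
  have i2 := integrableOn_hankelDerivIntegrand (by linarith) ha1 x
  have i3 := (integrableOn_hankelIntegrand (b := a - 1) (by linarith) (by linarith)
    hx.le).const_mul (Complex.I * a * x)
  have i0 := integrableOn_hankelIntegrand (b := a) (by linarith) ha1 hx.le
  have i12 : Integrable (fun s => Complex.I * hankelIntegrand a x s + hankelDerivIntegrand a x s)
      (volume.restrict (Ioi 0)) := i1.add i2
  have hi : IntegrableOn (fun s => Complex.I * (Complex.I * hankelIntegrand a x s
      + hankelDerivIntegrand a x s - Complex.I * a * x * hankelIntegrand (a - 1) x s)) (Ioi 0) :=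
    (i12.sub i3).const_mul Complex.I
  have hd : ∀ s ∈ Ioi (0 : ℝ), _ := fun s hs => hasDerivAt_hankelIntegrand a x hs
  have hz : hankelIntegrand a x 0 = 0 := by
    simp [hankelIntegrand, Real.zero_rpow (show a ≠ 0 by linarith)]
  have hc : ContinuousWithinAt (hankelIntegrand a x) (Ici 0) 0 := by
    rw [← continuousWithinAt_Ioi_iff_Ici, ContinuousWithinAt, hz]
    exact tendsto_hankelIntegrand_zero (by linarith) hx.le
  -- Both boundary terms vanish: at `0` because `a > 0`, at infinity because the function and its
  -- derivative are integrable.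
  have h := integral_Ioi_of_hasDerivAt_of_tendsto hc hd hi
    (tendsto_zero_of_hasDerivAt_of_integrableOn_Ioi hd hi i0)
  rw [hz, sub_zero, integral_const_mul, integral_sub i12 i3, integral_add i1 i2,
    integral_const_mul, integral_const_mul] at h
  have h' := (mul_eq_zero.1 h).resolve_left Complex.I_ne_zero
  exact sub_eq_zero.1 h'

/-- With the phase included, the derivative gains a factor `x`. Hence the momentum contributes only
at order `k²/H`, apart from the term `(1 - a) H`. -/
theorem hasDerivAt_exp_mul_hankelKernel {a x : ℝ} (ha : 1 / 2 < a) (ha1 : a ≤ 1) (hx : 0 < x) :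
    HasDerivAt (fun y : ℝ => Complex.exp (Complex.I * y) * hankelKernel a y)
      (Complex.I * a * x * Complex.exp (Complex.I * x) * hankelKernel (a - 1) x) x := by
  have h1 : HasDerivAt (fun y : ℝ => Complex.exp (Complex.I * y))
      (Complex.exp (Complex.I * x) * Complex.I) x := by
    have := (((hasDerivAt_id (x : ℂ)).const_mul Complex.I).cexp).comp_ofReal
    simpa using this
  have h2 := h1.mul (hasDerivAt_hankelKernel_integral (by linarith) ha1 hx)
  refine h2.congr_deriv ?_
  linear_combination Complex.exp (Complex.I * x) * I_mul_hankelKernel_add ha ha1 hx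

/-! ### Mode functions and their time derivatives on the slice. -/

/-- The Bunch-Davies amplitude of momentum `k` with its phase and the factor `H^a` removed, as a
function of the Fourier coefficients `F`, `G` of the smearing functions; here `a = ν - 1/2`. -/
def reducedAmplitude (a H k : ℝ) (F G : ℂ) : ℂ :=
  ((k ^ (-(a + 1 / 2)) / (Real.sqrt 2 * Real.Gamma (a + 1)) : ℝ) : ℂ)
    * (hankelKernel a (k / H) * (F + ((1 - a) * H : ℝ) * G)
      + Complex.I * a * (k ^ 2 / H : ℝ) * hankelKernel (a - 1) (k / H) * G)

/-- The constant phase and normalization of the Bunch-Davies mode functions. -/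
def bdPrefactor (a : ℝ) : ℂ :=
  Complex.exp (-(Complex.I * ((a + 1 / 2) * Real.pi / 2 + Real.pi / 4 : ℝ)))
    / (Real.sqrt 2 * Real.Gamma (a + 1) : ℝ)

theorem negConformalTime_pos {H : ℝ} (hH : 0 < H) (t : ℝ) : 0 < negConformalTime H t := by
  unfold negConformalTime
  positivity

/-- The explicit powers of conformal time collect to `τ^{1-a}`. This factor is constant at `a = 1`,
and its derivative is the origin of the term `(1 - a) H`. -/
theorem bunchDaviesMode_eq {m H k : ℝ} (hH : 0 < H) (hk : 0 < k) {a : ℝ}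
    (ha : bdIndex m H = a + 1 / 2) (t : ℝ) :
    bunchDaviesMode m H k t = bdPrefactor a * (H * k ^ (-(a + 1 / 2)) : ℝ)
      * ((negConformalTime H t ^ (1 - a) : ℝ)
        * (Complex.exp (Complex.I * (k * negConformalTime H t : ℝ))
          * hankelKernel a (k * negConformalTime H t))) := by
  have hτ := negConformalTime_pos hH t
  set τ := negConformalTime H t
  rw [bunchDaviesMode, ha, hankelOne_eq (by positivity), bdPrefactor]
  have h1 : Real.sqrt Real.pi / 2 * Real.sqrt (2 / Real.pi) = 1 / Real.sqrt 2 := by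
    rw [Real.sqrt_div (by norm_num)]
    have h2 : Real.sqrt 2 ^ 2 = 2 := Real.sq_sqrt (by norm_num)
    have hpi : Real.sqrt Real.pi ≠ 0 := by positivity
    field_simp
    linarith
  have h2 : τ ^ (3 / 2 : ℝ) * (k * τ) ^ (-(a + 1 / 2)) = k ^ (-(a + 1 / 2)) * τ ^ (1 - a) := by
    rw [Real.mul_rpow hk.le hτ.le, mul_left_comm, ← Real.rpow_add hτ]
    ring_nf
  have h1' := congrArg (fun r : ℝ => (r : ℂ)) h1
  have h2' := congrArg (fun r : ℝ => (r : ℂ)) h2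
  simp only [Complex.ofReal_mul, Complex.ofReal_div, Complex.ofReal_one] at h1' h2'
  rw [show a + 1 / 2 + 1 / 2 = a + 1 by ring, show a + 1 / 2 - 1 / 2 = a by ring]
  change (((Real.sqrt Real.pi / 2 * H * τ ^ (3 / 2 : ℝ) : ℝ) : ℂ)) * _ = _
  simp only [Complex.ofReal_mul, Complex.ofReal_div]
  generalize Complex.exp (-(Complex.I * _)) = P
  generalize Complex.exp (Complex.I * _) = Q
  generalize hankelKernel a (k * τ) = K
  calc _ = ((Real.sqrt Real.pi : ℂ) / ((2 : ℝ) : ℂ) * (Real.sqrt (2 / Real.pi) : ℂ))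
        * (((τ ^ (3 / 2 : ℝ) : ℝ) : ℂ) * (((k * τ) ^ (-(a + 1 / 2)) : ℝ) : ℂ))
        * (H * P / (Real.Gamma (a + 1) : ℂ) * Q * K) := by ring
    _ = _ := by
        rw [h1', h2', div_mul_eq_div_div]
        ring

theorem hasDerivAt_negConformalTime {H : ℝ} (hH : 0 < H) :
    HasDerivAt (negConformalTime H) (-1) 0 := by
  have h := (((hasDerivAt_id (0 : ℝ)).const_mul H).neg.exp).div_const H
  refine HasDerivAt.congr_deriv (f' := Real.exp (-(H * 0)) * (-(H * 1)) / H) h ?_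
  rw [mul_zero, neg_zero, Real.exp_zero]
  field_simp

theorem negConformalTime_zero (H : ℝ) : negConformalTime H 0 = H⁻¹ := by
  simp [negConformalTime]

theorem bunchDaviesMode_zero {m H k : ℝ} (hH : 0 < H) (hk : 0 < k) {a : ℝ}
    (ha : bdIndex m H = a + 1 / 2) :
    bunchDaviesMode m H k 0 = bdPrefactor a * (H ^ a * k ^ (-(a + 1 / 2)) : ℝ)
      * (Complex.exp (Complex.I * (k / H : ℝ)) * hankelKernel a (k / H)) := by
  have h : H * (H⁻¹) ^ (1 - a) = H ^ a := by
    rw [Real.inv_rpow hH.le, ← Real.rpow_neg hH.le, neg_sub, Real.rpow_sub_one hH.ne',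
      mul_div_cancel₀ _ hH.ne']
  rw [bunchDaviesMode_eq hH hk ha, negConformalTime_zero, ← h, ← div_eq_mul_inv]
  push_cast
  ring

theorem deriv_bunchDaviesMode {m H k : ℝ} (hH : 0 < H) (hk : 0 < k) {a : ℝ}
    (ha : bdIndex m H = a + 1 / 2) (ha0 : 1 / 2 < a) (ha1 : a ≤ 1) :
    deriv (bunchDaviesMode m H k) 0 = -(bdPrefactor a * (H ^ a * k ^ (-(a + 1 / 2)) : ℝ)
      * (Complex.exp (Complex.I * (k / H : ℝ)) * (((1 - a) * H : ℝ) * hankelKernel a (k / H)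
        + Complex.I * a * (k ^ 2 / H : ℝ) * hankelKernel (a - 1) (k / H)))) := by
  have hτ : 0 < negConformalTime H 0 := negConformalTime_pos hH 0
  have h1 := ((hasDerivAt_negConformalTime hH).rpow_const (p := 1 - a)
    (Or.inl hτ.ne')).ofReal_comp
  have h2 : HasDerivAt (fun t => k * negConformalTime H t) (k * (-1)) 0 :=
    (hasDerivAt_negConformalTime hH).const_mul k
  have h3 := (hasDerivAt_exp_mul_hankelKernel ha0 ha1 (mul_pos hk hτ)).scomp (0 : ℝ) h2
  have h4 := (h1.mul h3).const_mul (bdPrefactor a * (H * k ^ (-(a + 1 / 2)) : ℝ))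
  have h5 : bunchDaviesMode m H k = fun t => bdPrefactor a * (H * k ^ (-(a + 1 / 2)) : ℝ)
      * ((negConformalTime H t ^ (1 - a) : ℝ)
        * (Complex.exp (Complex.I * (k * negConformalTime H t : ℝ))
          * hankelKernel a (k * negConformalTime H t))) :=
    funext fun t => bunchDaviesMode_eq hH hk ha t
  rw [h5]
  refine (HasDerivAt.deriv h4).trans ?_
  rw [negConformalTime_zero]
  have e1 : (H⁻¹) ^ (1 - a - 1) = H ^ a := by
    rw [Real.inv_rpow hH.le, ← Real.rpow_neg hH.le]
    ring_nf
  have e2 : (H⁻¹) ^ (1 - a) = H ^ a / H := by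
    rw [Real.inv_rpow hH.le, ← Real.rpow_neg hH.le, ← Real.rpow_sub_one hH.ne']
    ring_nf
  simp only [e1, e2, ← div_eq_mul_inv, Function.comp, negConformalTime_zero]
  have hH' : (H : ℂ) ≠ 0 := by exact_mod_cast hH.ne'
  simp only [Complex.real_smul]
  push_cast
  field_simp
  ring

/-- One Bunch-Davies Fourier coefficient, up to a phase depending only on the momentum. -/
theorem exists_phase_bunchDavies {m H k : ℝ} (hH : 0 < H) (hk : 0 < k) {a : ℝ}
    (ha : bdIndex m H = a + 1 / 2) (ha0 : 1 / 2 < a) (ha1 : a ≤ 1) :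
    ∃ φ : ℂ, φ * conj φ = 1 ∧ ∀ F G : ℂ,
      bunchDaviesMode m H k 0 * F - deriv (bunchDaviesMode m H k) 0 * G
        = φ * ((H ^ a : ℝ) * reducedAmplitude a H k F G) := by
  refine ⟨Complex.exp ((-((a + 1 / 2) * Real.pi / 2 + Real.pi / 4) + k / H : ℝ) * Complex.I), ?_, ?_⟩
  · rw [Complex.mul_conj, Complex.normSq_eq_norm_sq, Complex.norm_exp_ofReal_mul_I]
    norm_num
  · intro F G
    have : Complex.exp ((-((a + 1 / 2) * Real.pi / 2 + Real.pi / 4) + k / H : ℝ) * Complex.I)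
        = Complex.exp (-(Complex.I * ((a + 1 / 2) * Real.pi / 2 + Real.pi / 4 : ℝ)))
          * Complex.exp (Complex.I * (k / H : ℝ)) := by
      rw [← Complex.exp_add]
      push_cast
      ring_nf
    rw [this, deriv_bunchDaviesMode hH hk ha ha0 ha1, bunchDaviesMode_zero hH hk ha, bdPrefactor,
      reducedAmplitude]
    generalize Complex.exp (-(Complex.I * _)) = P
    generalize Complex.exp (Complex.I * _) = Q
    push_cast
    ring

theorem reducedAmplitude_linear (a H k c d : ℝ) (F₁ G₁ F₂ G₂ : ℂ) :
    c * reducedAmplitude a H k F₁ G₁ + d * reducedAmplitude a H k F₂ G₂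
      = reducedAmplitude a H k (c * F₁ + d * F₂) (c * G₁ + d * G₂) := by
  simp only [reducedAmplitude]
  ring

theorem minkowskiMode_zero (k : ℝ) : minkowskiMode k 0 = ((Real.sqrt (2 * k))⁻¹ : ℝ) := by
  simp [minkowskiMode]

theorem deriv_minkowskiMode (k : ℝ) :
    deriv (minkowskiMode k) 0 = -(Complex.I * k * ((Real.sqrt (2 * k))⁻¹ : ℝ)) := by
  have h : HasDerivAt (fun z : ℂ => Complex.exp (-(Complex.I * k * z)) / (Real.sqrt (2 * k) : ℂ))
      (Complex.exp (-(Complex.I * k * 0)) * (-(Complex.I * k * 1)) / (Real.sqrt (2 * k) : ℂ))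
      ((0 : ℝ) : ℂ) := by
    rw [Complex.ofReal_zero]
    exact (((hasDerivAt_id (0 : ℂ)).const_mul (Complex.I * (k : ℂ))).neg.cexp).div_const _
  refine h.comp_ofReal.deriv.trans ?_
  rw [mul_zero, neg_zero, Complex.exp_zero]
  push_cast
  ring

/-! ### Gram determinants through Lagrange's identity. -/

/-- The integrand of Lagrange's identity for the Gram determinant, with respect to the real inner
product `Re (z * conj w)`, of two complex-valued functions. -/
def gramDensity (z₁ z₂ w₁ w₂ : ℂ) : ℝ :=
  Complex.normSq z₁ * Complex.normSq w₂ + Complex.normSq w₁ * Complex.normSq z₂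
    - 2 * ((z₁ * conj z₂).re * (w₁ * conj w₂).re)

/-- The squares are those of the real 2×2 minors pairing a real or imaginary part at one point with
one at the other. Nonnegativity makes Fatou's lemma available, and a change of basis multiplies
every minor by its determinant. -/
theorem gramDensity_eq_sum_sq (z₁ z₂ w₁ w₂ : ℂ) :
    gramDensity z₁ z₂ w₁ w₂ = (z₁.re * w₂.re - w₁.re * z₂.re) ^ 2
      + (z₁.re * w₂.im - w₁.im * z₂.re) ^ 2 + (z₁.im * w₂.re - w₁.re * z₂.im) ^ 2
      + (z₁.im * w₂.im - w₁.im * z₂.im) ^ 2 := by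
  simp only [gramDensity, Complex.normSq_apply, Complex.mul_re, Complex.conj_re, Complex.conj_im]
  ring

theorem gramDensity_nonneg (z₁ z₂ w₁ w₂ : ℂ) : 0 ≤ gramDensity z₁ z₂ w₁ w₂ := by
  rw [gramDensity_eq_sum_sq]
  positivity

theorem gramDensity_linear (a b c d : ℝ) (z₁ z₂ w₁ w₂ : ℂ) :
    gramDensity (a * z₁ + b * z₂) (c * z₁ + d * z₂) (a * w₁ + b * w₂) (c * w₁ + d * w₂)
      = (a * d - b * c) ^ 2 * gramDensity z₁ z₂ w₁ w₂ := by
  simp only [gramDensity_eq_sum_sq, Complex.add_re, Complex.add_im, Complex.re_ofReal_mul,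
    Complex.im_ofReal_mul]
  ring

/-- Only products of two values at the same point enter, so the phase may vary from point to point.
-/
theorem gramDensity_phase {φ ψ : ℂ} (hφ : φ * conj φ = 1) (hψ : ψ * conj ψ = 1)
    (z₁ z₂ w₁ w₂ : ℂ) :
    gramDensity (φ * z₁) (φ * z₂) (ψ * w₁) (ψ * w₂) = gramDensity z₁ z₂ w₁ w₂ := by
  have h : ∀ {φ : ℂ}, φ * conj φ = 1 → ∀ z w : ℂ, φ * z * conj (φ * w) = z * conj w := by
    intro φ h z w
    rw [map_mul]
    linear_combination z * conj w * h
  have h' : ∀ {φ : ℂ}, φ * conj φ = 1 → Complex.normSq φ = 1 := by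
    intro φ h
    rw [Complex.mul_conj] at h
    exact_mod_cast h
  simp only [gramDensity, h hφ, h hψ, Complex.normSq_mul, h' hφ, h' hψ, one_mul]

theorem continuous_gramDensity :
    Continuous fun p : ℂ × ℂ × ℂ × ℂ => gramDensity p.1 p.2.1 p.2.2.1 p.2.2.2 := by
  simp only [gramDensity_eq_sum_sq]
  fun_prop

/-- A vanishing Gram density forces a real linear relation determined by its first arguments. -/
theorem exists_relation_of_gramDensity_eq_zero {z₁ z₂ : ℂ} (hz : z₁ ≠ 0) :
    ∃ a b : ℝ, (a ≠ 0 ∨ b ≠ 0) ∧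
      ∀ w₁ w₂ : ℂ, gramDensity z₁ z₂ w₁ w₂ = 0 → a * w₁ + b * w₂ = 0 := by
  have key : ∀ w₁ w₂ : ℂ, gramDensity z₁ z₂ w₁ w₂ = 0 →
      z₁.re * w₂.re - w₁.re * z₂.re = 0 ∧ z₁.re * w₂.im - w₁.im * z₂.re = 0 ∧
      z₁.im * w₂.re - w₁.re * z₂.im = 0 ∧ z₁.im * w₂.im - w₁.im * z₂.im = 0 := by
    intro w₁ w₂ h
    rw [gramDensity_eq_sum_sq] at h
    refine ⟨?_, ?_, ?_, ?_⟩ <;> refine pow_eq_zero_iff (two_ne_zero) |>.1 ?_ <;> nlinarith [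
      sq_nonneg (z₁.re * w₂.re - w₁.re * z₂.re), sq_nonneg (z₁.re * w₂.im - w₁.im * z₂.re),
      sq_nonneg (z₁.im * w₂.re - w₁.re * z₂.im), sq_nonneg (z₁.im * w₂.im - w₁.im * z₂.im)]
  by_cases hre : z₁.re = 0
  · have him : z₁.im ≠ 0 := fun h => hz (Complex.ext hre h)
    refine ⟨-z₂.im, z₁.im, Or.inr him, fun w₁ w₂ h => ?_⟩
    obtain ⟨_, _, h3, h4⟩ := key w₁ w₂ h
    apply Complex.ext <;> simp only [Complex.add_re, Complex.add_im, Complex.re_ofReal_mul,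
      Complex.im_ofReal_mul, Complex.zero_re, Complex.zero_im] <;> linarith
  · refine ⟨-z₂.re, z₁.re, Or.inr hre, fun w₁ w₂ h => ?_⟩
    obtain ⟨h1, h2, _, _⟩ := key w₁ w₂ h
    apply Complex.ext <;> simp only [Complex.add_re, Complex.add_im, Complex.re_ofReal_mul,
      Complex.im_ofReal_mul, Complex.zero_re, Complex.zero_im] <;> linarith

section Gram

variable {α : Type*} [MeasurableSpace α] {μ : Measure α}

/-- Twice the Gram determinant of two complex-valued functions for the real inner product of
`L²`, defined without integrability assumptions. -/
def gramIntegral (μ : Measure α) (v₁ v₂ : α → ℂ) : ENNReal :=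
  ∫⁻ p : α × α, ENNReal.ofReal (gramDensity (v₁ p.1) (v₂ p.1) (v₁ p.2) (v₂ p.2)) ∂(μ.prod μ)

theorem aemeasurable_gramDensity [SFinite μ] {v₁ v₂ : α → ℂ} (h₁ : AEStronglyMeasurable v₁ μ)
    (h₂ : AEStronglyMeasurable v₂ μ) : AEMeasurable (fun p : α × α =>
      ENNReal.ofReal (gramDensity (v₁ p.1) (v₂ p.1) (v₁ p.2) (v₂ p.2))) (μ.prod μ) := by
  have m := fun {v : α → ℂ} (h : AEStronglyMeasurable v μ) =>
    And.intro (h.comp_fst (ν := μ)) (h.comp_snd (μ := μ))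
  exact (continuous_gramDensity.comp_aestronglyMeasurable ((m h₁).1.prodMk
    ((m h₂).1.prodMk ((m h₁).2.prodMk (m h₂).2)))).aemeasurable.ennreal_ofReal

theorem gramIntegral_linear (a b c d : ℝ) (v₁ v₂ : α → ℂ) :
    gramIntegral μ (fun x => a * v₁ x + b * v₂ x) (fun x => c * v₁ x + d * v₂ x)
      = ENNReal.ofReal ((a * d - b * c) ^ 2) * gramIntegral μ v₁ v₂ := by
  simp only [gramIntegral, gramDensity_linear, ENNReal.ofReal_mul (sq_nonneg (a * d - b * c))]
  exact lintegral_const_mul' _ _ ENNReal.ofReal_ne_top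

theorem gramIntegral_congr_phase [SFinite μ] {v₁ v₂ w₁ w₂ : α → ℂ}
    (h : ∀ᵐ x ∂μ, ∃ φ : ℂ, φ * conj φ = 1 ∧ v₁ x = φ * w₁ x ∧ v₂ x = φ * w₂ x) :
    gramIntegral μ v₁ v₂ = gramIntegral μ w₁ w₂ := by
  refine lintegral_congr_ae ?_
  filter_upwards [Measure.quasiMeasurePreserving_fst.ae h,
    Measure.quasiMeasurePreserving_snd.ae h] with p ⟨φ, hφ, h1, h2⟩ ⟨ψ, hψ, h3, h4⟩
  rw [h1, h2, h3, h4, gramDensity_phase hφ hψ]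

/-- The Gram determinant is lower semicontinuous under pointwise convergence. -/
theorem gramIntegral_le_liminf [SFinite μ] {v₁ v₂ : ℕ → α → ℂ} {V₁ V₂ : α → ℂ}
    (m₁ : ∀ n, AEStronglyMeasurable (v₁ n) μ) (m₂ : ∀ n, AEStronglyMeasurable (v₂ n) μ)
    (h₁ : ∀ᵐ x ∂μ, Tendsto (fun n => v₁ n x) atTop (𝓝 (V₁ x)))
    (h₂ : ∀ᵐ x ∂μ, Tendsto (fun n => v₂ n x) atTop (𝓝 (V₂ x))) :
    gramIntegral μ V₁ V₂ ≤ liminf (fun n => gramIntegral μ (v₁ n) (v₂ n)) atTop := by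
  refine le_trans (lintegral_mono_ae ?_)
    (lintegral_liminf_le' fun n => aemeasurable_gramDensity (m₁ n) (m₂ n))
  filter_upwards [Measure.quasiMeasurePreserving_fst.ae h₁,
    Measure.quasiMeasurePreserving_snd.ae h₁, Measure.quasiMeasurePreserving_fst.ae h₂,
    Measure.quasiMeasurePreserving_snd.ae h₂] with p a1 a2 b1 b2
  have := (continuous_gramDensity.tendsto (V₁ p.1, V₂ p.1, V₁ p.2, V₂ p.2)).comp
    (a1.prodMk_nhds (b1.prodMk_nhds (a2.prodMk_nhds b2)))
  exact (ENNReal.tendsto_ofReal this).liminf_eq.ge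

/-- A vanishing Gram determinant means real linear dependence. -/
theorem exists_relation_of_gramIntegral_eq_zero [SFinite μ] {V₁ V₂ : α → ℂ}
    (m₁ : AEStronglyMeasurable V₁ μ) (m₂ : AEStronglyMeasurable V₂ μ)
    (h : gramIntegral μ V₁ V₂ = 0) :
    ∃ a b : ℝ, (a ≠ 0 ∨ b ≠ 0) ∧ ∀ᵐ x ∂μ, a * V₁ x + b * V₂ x = 0 := by
  by_cases h0 : ∀ᵐ x ∂μ, V₁ x = 0
  · refine ⟨1, 0, Or.inl one_ne_zero, ?_⟩
    filter_upwards [h0] with x hx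
    simp [hx]
  · rw [gramIntegral, lintegral_eq_zero_iff' (aemeasurable_gramDensity m₁ m₂)] at h
    -- One point with `V₁ x ≠ 0` and an almost everywhere vanishing slice is enough: the relation it
    -- determines holds at almost every other point.
    obtain ⟨x, hx, hy⟩ :=
      ((not_eventually.1 h0).and_eventually (Measure.ae_ae_of_ae_prod h)).exists
    obtain ⟨a, b, hab, key⟩ := exists_relation_of_gramDensity_eq_zero (z₂ := V₂ x) hx
    refine ⟨a, b, hab, ?_⟩
    filter_upwards [hy] with y hy
    exact key _ _ (le_antisymm (ENNReal.ofReal_eq_zero.1 hy) (gramDensity_nonneg _ _ _ _))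

theorem integrable_mul_conj {v₁ v₂ : α → ℂ} (m₁ : MemLp v₁ 2 μ) (m₂ : MemLp v₂ 2 μ) :
    Integrable (fun x => v₁ x * conj (v₂ x)) μ :=
  MemLp.integrable_mul m₁ m₂.star

/-- Fubini's theorem on the expanded density; the factor `2` counts both orders of the two points.
-/
theorem gramIntegral_eq [SFinite μ] {v₁ v₂ : α → ℂ} (m₁ : MemLp v₁ 2 μ) (m₂ : MemLp v₂ 2 μ) :
    gramIntegral μ v₁ v₂ = ENNReal.ofReal (2 * ((∫ x, (v₁ x * conj (v₁ x)).re ∂μ)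
      * (∫ x, (v₂ x * conj (v₂ x)).re ∂μ) - (∫ x, (v₁ x * conj (v₂ x)).re ∂μ) ^ 2)) := by
  have i11 := (integrable_mul_conj m₁ m₁).re
  have i22 := (integrable_mul_conj m₂ m₂).re
  have i12 := (integrable_mul_conj m₁ m₂).re
  simp only [RCLike.re_to_complex] at i11 i22 i12
  have e : ∀ p : α × α, gramDensity (v₁ p.1) (v₂ p.1) (v₁ p.2) (v₂ p.2)
      = (v₁ p.1 * conj (v₁ p.1)).re * (v₂ p.2 * conj (v₂ p.2)).re
        + (v₂ p.1 * conj (v₂ p.1)).re * (v₁ p.2 * conj (v₁ p.2)).re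
        - 2 * ((v₁ p.1 * conj (v₂ p.1)).re * (v₁ p.2 * conj (v₂ p.2)).re) := by
    intro p
    simp only [gramDensity, Complex.mul_conj, Complex.ofReal_re]
    ring
  have j1 := i11.mul_prod i22
  have j2 := i22.mul_prod i11
  have j3 := (i12.mul_prod i12).const_mul 2
  have j12 : Integrable (fun p : α × α =>
      (v₁ p.1 * conj (v₁ p.1)).re * (v₂ p.2 * conj (v₂ p.2)).re
        + (v₂ p.1 * conj (v₂ p.1)).re * (v₁ p.2 * conj (v₁ p.2)).re) (μ.prod μ) := j1.add j2
  have hi : Integrable (fun p : α × α =>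
      gramDensity (v₁ p.1) (v₂ p.1) (v₁ p.2) (v₂ p.2)) (μ.prod μ) := by
    simp only [e]
    exact j12.sub j3
  rw [gramIntegral, ← ofReal_integral_eq_lintegral_ofReal hi
    (Eventually.of_forall fun p => gramDensity_nonneg _ _ _ _)]
  congr 1
  simp only [e]
  have q : ∀ f g : α → ℝ, ∫ p : α × α, f p.1 * g p.2 ∂(μ.prod μ)
      = (∫ x, f x ∂μ) * ∫ x, g x ∂μ := fun f g => integral_prod_mul f g
  have q1 := q (fun x => (v₁ x * conj (v₁ x)).re) (fun x => (v₂ x * conj (v₂ x)).re)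
  have q2 := q (fun x => (v₂ x * conj (v₂ x)).re) (fun x => (v₁ x * conj (v₁ x)).re)
  have q3 := q (fun x => (v₁ x * conj (v₂ x)).re) (fun x => (v₁ x * conj (v₂ x)).re)
  rw [integral_sub j12 j3, integral_add j1 j2, integral_const_mul, q1, q2, q3]
  ring

end Gram

/-! ### The covariance determinant as a Gram determinant. -/

theorem covariance_eq {u : ℝ → ℝ → ℂ} {A : SingleMode}
    (h : ∀ i, MemLp (amplitude u (A.γ i)) 2) (i j : Fin 2) :
    covariance u A i j
      = 2 * ∫ ξ, (amplitude u (A.γ i) ξ * conj (amplitude u (A.γ j) ξ)).re := by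
  have e : ∀ i j, (twoPoint u (A.γ i) (A.γ j)).re
      = ∫ ξ, (amplitude u (A.γ i) ξ * conj (amplitude u (A.γ j) ξ)).re := fun i j =>
    (integral_re (integrable_mul_conj (h i) (h j))).symm
  rw [covariance, Complex.add_re, e, e, two_mul]
  congr 1
  refine integral_congr_ae (Eventually.of_forall fun ξ => ?_)
  simp only [Complex.mul_re, Complex.conj_re, Complex.conj_im]
  ring

/-- Each covariance entry is twice a real inner product, so the determinant is four Gram
determinants, that is, two `gramIntegral`s. -/
theorem ofReal_det_covariance {u : ℝ → ℝ → ℂ} {A : SingleMode}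
    (h : ∀ i, MemLp (amplitude u (A.γ i)) 2) :
    ENNReal.ofReal (covariance u A).det
      = 2 * gramIntegral volume (amplitude u (A.γ 0)) (amplitude u (A.γ 1)) := by
  have h2 : ∀ r : ℝ, 2 * ENNReal.ofReal r = ENNReal.ofReal (2 * r) := fun r => by
    rw [ENNReal.ofReal_mul (by norm_num), ENNReal.ofReal_ofNat]
  rw [gramIntegral_eq (h 0) (h 1), Matrix.det_fin_two, h2]
  have h10 : ∀ ξ, (amplitude u (A.γ 1) ξ * conj (amplitude u (A.γ 0) ξ)).re
      = (amplitude u (A.γ 0) ξ * conj (amplitude u (A.γ 1) ξ)).re := fun ξ => by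
    simp only [Complex.mul_re, Complex.conj_re, Complex.conj_im]
    ring
  simp only [covariance_eq h, h10]
  congr 1
  ring

/-! ### Test functions and their Fourier transforms. -/

/-- Smooth compactly supported real functions. -/
structure IsTestFunction (h : Space → ℝ) : Prop where
  smooth : ContDiff ℝ ∞ h
  compact : HasCompactSupport h

/-- The Fourier transform of a real function. -/
def realFourier (h : Space → ℝ) (ξ : Space) : ℂ := 𝓕 (fun x : Space => (h x : ℂ)) ξ

namespace IsTestFunction

variable {h h₁ h₂ : Space → ℝ}

theorem linear (t₁ : IsTestFunction h₁) (t₂ : IsTestFunction h₂) (a b : ℝ) :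
    IsTestFunction fun x => a * h₁ x + b * h₂ x where
  smooth := (contDiff_const.mul t₁.smooth).add (contDiff_const.mul t₂.smooth)
  compact := HasCompactSupport.add (f := fun x => a * h₁ x) (f' := fun x => b * h₂ x)
    t₁.compact.mul_left t₂.compact.mul_left

/-- A test function as a complex-valued Schwartz function. -/
def toSchwartz (t : IsTestFunction h) : 𝓢(Space, ℂ) :=
  HasCompactSupport.toSchwartzMap (f := fun x => (h x : ℂ))
    (t.compact.comp_left Complex.ofReal_zero) (Complex.ofRealCLM.contDiff.comp t.smooth)

theorem toSchwartz_apply (t : IsTestFunction h) (x : Space) : t.toSchwartz x = (h x : ℂ) := rfl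

theorem realFourier_eq (t : IsTestFunction h) (ξ : Space) :
    realFourier h ξ = (𝓕 t.toSchwartz : 𝓢(Space, ℂ)) ξ := rfl

theorem continuous_realFourier (t : IsTestFunction h) : Continuous (realFourier h) :=
  (𝓕 t.toSchwartz : 𝓢(Space, ℂ)).continuous

theorem realFourier_decay (t : IsTestFunction h) (n : ℕ) :
    ∃ C, 0 ≤ C ∧ ∀ ξ, (1 + ‖ξ‖) ^ n * ‖realFourier h ξ‖ ≤ C := by
  have key : ∀ ξ, (1 + ‖ξ‖) ^ n * ‖realFourier h ξ‖ ≤ 2 ^ n *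
      (Finset.Iic (n, 0)).sup (fun m => SchwartzMap.seminorm ℂ m.1 m.2) (𝓕 t.toSchwartz) := by
    intro ξ
    have := SchwartzMap.one_add_le_sup_seminorm_apply (𝕜 := ℂ) (m := (n, 0)) (k := n) (n := 0)
      le_rfl le_rfl (𝓕 t.toSchwartz) ξ
    rwa [norm_iteratedFDeriv_zero] at this
  exact ⟨_, le_trans (by positivity) (key 0), key⟩

theorem realFourier_linear (t₁ : IsTestFunction h₁) (t₂ : IsTestFunction h₂) (a b : ℝ)
    (ξ : Space) :
    realFourier (fun x => a * h₁ x + b * h₂ x) ξ = a * realFourier h₁ ξ + b * realFourier h₂ ξ := by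
  have e : (t₁.linear t₂ a b).toSchwartz = (a : ℂ) • t₁.toSchwartz + (b : ℂ) • t₂.toSchwartz := by
    ext x
    simp [toSchwartz_apply]
  rw [realFourier_eq (t₁.linear t₂ a b), e, FourierTransform.fourier_add,
    FourierTransform.fourier_smul, FourierTransform.fourier_smul]
  simp [realFourier_eq t₁, realFourier_eq t₂]

theorem eq_zero_of_realFourier (t : IsTestFunction h) (h0 : ∀ ξ, realFourier h ξ = 0) (x : Space) :
    h x = 0 := by
  have e : (𝓕 t.toSchwartz : 𝓢(Space, ℂ)) = 0 := by
    ext ξ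
    rw [← t.realFourier_eq, h0]
    rfl
  have e' : t.toSchwartz = 0 := by
    rw [← FourierTransform.fourierInv_fourier_eq (F := 𝓢(Space, ℂ)) t.toSchwartz, e]
    exact map_zero (FourierTransform.fourierCLE ℂ 𝓢(Space, ℂ)).symm
  have := DFunLike.congr_fun e' x
  rwa [toSchwartz_apply, _root_.zero_apply, Complex.ofReal_eq_zero] at this

theorem laplacian (t : IsTestFunction h) : IsTestFunction (Laplacian.laplacian h) := by
  have e : Laplacian.laplacian h = fun x => ∑ i : Fin 3,
      iteratedFDeriv ℝ 2 h x ![EuclideanSpace.basisFun (Fin 3) ℝ i,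
        EuclideanSpace.basisFun (Fin 3) ℝ i] := by
    rw [InnerProductSpace.laplacian_eq_iteratedFDeriv_orthonormalBasis h
      (EuclideanSpace.basisFun (Fin 3) ℝ)]
  rw [e]
  constructor
  · refine ContDiff.sum fun i _ => ?_
    have := t.smooth.iteratedFDeriv_right (m := ∞) (i := 2) le_rfl
    exact (ContinuousMultilinearMap.apply ℝ (fun _ : Fin 2 => Space) ℝ _).contDiff.comp this
  · have := t.compact.iteratedFDeriv (𝕜 := ℝ) 2
    exact this.comp_left (g := fun L : ContinuousMultilinearMap ℝ (fun _ : Fin 2 => Space) ℝ =>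
      ∑ i : Fin 3, L ![EuclideanSpace.basisFun (Fin 3) ℝ i,
        EuclideanSpace.basisFun (Fin 3) ℝ i]) (by simp)

theorem realFourier_laplacian (t : IsTestFunction h) (ξ : Space) :
    realFourier (Laplacian.laplacian h) ξ
      = -(((2 * Real.pi * ‖ξ‖) ^ 2 : ℝ) : ℂ) * realFourier h ξ := by
  have e : t.laplacian.toSchwartz = Δ t.toSchwartz := by
    ext x
    rw [SchwartzMap.laplacian_apply]
    exact (ContDiffAt.laplacian_CLM_comp_left (l := Complex.ofRealCLM)
      ((t.smooth.of_le (m := 2) (by norm_cast)).contDiffAt (x := x))).symm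
  rw [t.laplacian.realFourier_eq, e, SchwartzMap.laplacian_eq_fourierMultiplierCLM,
    FourierTransform.fourier_smul, SchwartzMap.fourierMultiplierCLM_apply,
    FourierTransform.fourier_fourierInv_eq, _root_.smul_apply,
    SchwartzMap.smulLeftCLM_apply_apply (by fun_prop), ← t.realFourier_eq]
  simp only [Complex.real_smul]
  push_cast
  ring

end IsTestFunction

theorem PhasePoint.isTestFunction_f (γ : PhasePoint) : IsTestFunction γ.f :=
  ⟨γ.smooth_f, γ.compact_f⟩

theorem PhasePoint.isTestFunction_g (γ : PhasePoint) : IsTestFunction γ.g :=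
  ⟨γ.smooth_g, γ.compact_g⟩

/-! ### Square integrability of amplitudes. -/

theorem amplitude_eq (u : ℝ → ℝ → ℂ) (γ : PhasePoint) (ξ : Space) :
    amplitude u γ ξ = u (2 * Real.pi * ‖ξ‖) 0 * realFourier γ.f ξ
      - deriv (u (2 * Real.pi * ‖ξ‖)) 0 * realFourier γ.g ξ := rfl

theorem two_pi_norm_pos {ξ : Space} (hξ : ξ ≠ 0) : 0 < 2 * Real.pi * ‖ξ‖ := by
  have := norm_pos_iff.2 hξ
  positivity

theorem ae_ne_zero : ∀ᵐ ξ : Space, ξ ≠ 0 := by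
  simp [ae_iff]

theorem aestronglyMeasurable_of_continuousOn {v : Space → ℂ} (hv : ContinuousOn v {0}ᶜ) :
    AEStronglyMeasurable v := by
  have := hv.aestronglyMeasurable (μ := volume) (measurableSet_singleton 0).compl
  rwa [restrict_compl_singleton] at this

theorem continuousOn_comp_two_pi_norm {p : ℝ → ℂ} (hp : ContinuousOn p (Ioi 0)) :
    ContinuousOn (fun ξ : Space => p (2 * Real.pi * ‖ξ‖)) {0}ᶜ :=
  hp.comp (by fun_prop) fun _ hξ => two_pi_norm_pos hξ

/-- An integrable radial weight, singular at the origin. -/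
theorem integrable_radial_weight {s : ℝ} (hs0 : 0 ≤ s) (hs : s < 3 / 2) :
    Integrable fun ξ : Space =>
      ((2 * Real.pi * ‖ξ‖) ^ (-s) / (1 + 2 * Real.pi * ‖ξ‖) ^ 4) ^ 2 := by
  set W : ℝ → ℝ := fun y => (y ^ (-s) / (1 + y) ^ 4) ^ 2 with hW
  have hcont : ContinuousOn (fun y : ℝ => y ^ 2 • W y) (Ioi 0) := by
    intro y hy
    have hy' : (0 : ℝ) < y := hy
    refine ContinuousAt.continuousWithinAt ?_
    have := Real.continuousAt_rpow_const y (-s) (Or.inl hy'.ne')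
    have h1 : (1 + y) ^ 4 ≠ 0 := by positivity
    simp only [hW]
    fun_prop (disch := assumption)
  have hmeas : ∀ t ⊆ Ioi (0 : ℝ), MeasurableSet t →
      AEStronglyMeasurable (fun y : ℝ => y ^ 2 • W y) (volume.restrict t) := fun t ht hm =>
    (hcont.mono ht).aestronglyMeasurable hm
  have hsq : ∀ y : ℝ, 0 < y → ‖y ^ 2 • W y‖ = y ^ (2 - 2 * s) / (1 + y) ^ 8 := by
    intro y hy
    have h0 : 0 ≤ y ^ 2 • W y := by simp only [hW, smul_eq_mul]; positivity
    rw [Real.norm_eq_abs, abs_of_nonneg h0, smul_eq_mul]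
    simp only [hW]
    rw [div_pow, ← Real.rpow_natCast (y ^ (-s)),
      ← Real.rpow_mul hy.le, ← pow_mul, ← Real.rpow_natCast y 2, ← mul_div_assoc,
      ← Real.rpow_add hy]
    push_cast
    ring_nf
  have h1 : IntegrableOn (fun y : ℝ => y ^ 2 • W y) (Ioc 0 1) := by
    -- In polar coordinates the infrared condition is `2 - 2s > -1`, which is `s < 3/2`.
    have i : IntegrableOn (fun y : ℝ => y ^ (2 - 2 * s)) (Ioc 0 1) :=
      (intervalIntegrable_iff_integrableOn_Ioc_of_le zero_le_one).1
        (intervalIntegral.intervalIntegrable_rpow' (by linarith))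
    refine i.mono' (hmeas _ Ioc_subset_Ioi_self measurableSet_Ioc) ?_
    filter_upwards [ae_restrict_mem measurableSet_Ioc] with y hy
    have hy' := hy.1
    rw [hsq y hy']
    exact div_le_self (by positivity) (one_le_pow₀ (by linarith))
  have h2 : IntegrableOn (fun y : ℝ => y ^ 2 • W y) (Ioi 1) := by
    refine (integrableOn_Ioi_rpow_of_lt (a := -2) (by norm_num) one_pos).mono'
      (hmeas _ (Ioi_subset_Ioi zero_le_one) measurableSet_Ioi) ?_
    filter_upwards [ae_restrict_mem measurableSet_Ioi] with y hy
    have hy1 : (1 : ℝ) < y := hy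
    have hy0 : 0 < y := by linarith
    rw [hsq y hy0, div_le_iff₀ (by positivity)]
    calc y ^ (2 - 2 * s) ≤ y ^ (-2 + ((4 : ℕ) : ℝ)) :=
          Real.rpow_le_rpow_of_exponent_le hy1.le (by norm_num; linarith)
      _ = y ^ (-2 : ℝ) * y ^ 4 := by rw [Real.rpow_add hy0, Real.rpow_natCast]
      _ ≤ y ^ (-2 : ℝ) * (1 + y) ^ 8 := by
          gcongr
          calc y ^ 4 ≤ (1 + y) ^ 4 := by gcongr; linarith
            _ ≤ (1 + y) ^ 8 := pow_le_pow_right₀ (by linarith) (by norm_num)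
  have h3 : Integrable fun ξ : Space => W ‖ξ‖ := by
    rw [integrable_fun_norm_addHaar, finrank_euclideanSpace_fin, ← Ioc_union_Ioi_eq_Ioi zero_le_one]
    exact h1.union h2
  have hpi : (2 * Real.pi) ≠ 0 := by positivity
  refine (h3.comp_smul hpi).congr (Eventually.of_forall fun ξ => ?_)
  simp only [norm_smul, Real.norm_eq_abs, abs_of_pos (show 0 < 2 * Real.pi by positivity), hW]

theorem memLp_two_of_coeff_bound {v : Space → ℂ} {C s : ℝ} (hs0 : 0 ≤ s) (hs : s < 3 / 2)
    (hv : AEStronglyMeasurable v)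
    (hb : ∀ ξ, ξ ≠ 0 →
      ‖v ξ‖ ≤ C * ((2 * Real.pi * ‖ξ‖) ^ (-s) / (1 + 2 * Real.pi * ‖ξ‖) ^ 4)) :
    MemLp v 2 := by
  rw [memLp_two_iff_integrable_sq_norm hv]
  refine ((integrable_radial_weight hs0 hs).const_mul (C ^ 2)).mono' (hv.norm.pow 2) ?_
  filter_upwards [ae_ne_zero] with ξ hξ
  rw [← mul_pow, Real.norm_eq_abs, abs_pow, abs_norm]
  exact pow_le_pow_left₀ (norm_nonneg _) (hb ξ hξ) 2

theorem memLp_amplitude {u : ℝ → ℝ → ℂ} {C s : ℝ} (hs0 : 0 ≤ s) (hs : s < 3 / 2)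
    (hu : ContinuousOn (fun k => u k 0) (Ioi 0))
    (hu' : ContinuousOn (fun k => deriv (u k) 0) (Ioi 0))
    (hb : ∀ k, 0 < k → ‖u k 0‖ ≤ C * (k ^ (-s) * (1 + k) ^ 3))
    (hb' : ∀ k, 0 < k → ‖deriv (u k) 0‖ ≤ C * (k ^ (-s) * (1 + k) ^ 3)) (γ : PhasePoint) :
    MemLp (amplitude u γ) 2 := by
  -- Three of the seven powers pay for the growth of the mode functions; four remain for the radial
  -- weight.
  obtain ⟨Cf, hCf, hf⟩ := γ.isTestFunction_f.realFourier_decay 7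
  obtain ⟨Cg, hCg, hg⟩ := γ.isTestFunction_g.realFourier_decay 7
  have hC : 0 ≤ C := by
    have := (norm_nonneg _).trans (hb 1 one_pos)
    rw [Real.one_rpow] at this
    nlinarith
  refine memLp_two_of_coeff_bound (C := C * (2 * Real.pi) ^ 7 * (Cf + Cg)) hs0 hs
    (aestronglyMeasurable_of_continuousOn ?_) fun ξ hξ => ?_
  · exact ((continuousOn_comp_two_pi_norm hu).mul
      γ.isTestFunction_f.continuous_realFourier.continuousOn).sub
      ((continuousOn_comp_two_pi_norm hu').mul
        γ.isTestFunction_g.continuous_realFourier.continuousOn)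
  · have hk := two_pi_norm_pos hξ
    have hpi : (1 : ℝ) ≤ 2 * Real.pi := by linarith [Real.pi_gt_three]
    have h1 : 1 + 2 * Real.pi * ‖ξ‖ ≤ 2 * Real.pi * (1 + ‖ξ‖) := by linarith
    set k := 2 * Real.pi * ‖ξ‖
    have key : ∀ {D : ℝ} {z : ℂ}, (1 + ‖ξ‖) ^ 7 * ‖z‖ ≤ D →
        ‖z‖ ≤ (2 * Real.pi) ^ 7 * D / (1 + k) ^ 7 := by
      intro D z hz
      rw [le_div_iff₀ (by positivity)]
      calc ‖z‖ * (1 + k) ^ 7 ≤ ‖z‖ * (2 * Real.pi * (1 + ‖ξ‖)) ^ 7 := by gcongr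
        _ = (2 * Real.pi) ^ 7 * ((1 + ‖ξ‖) ^ 7 * ‖z‖) := by ring
        _ ≤ _ := by gcongr
    rw [amplitude_eq]
    calc _ ≤ ‖u k 0‖ * ‖realFourier γ.f ξ‖ + ‖deriv (u k) 0‖ * ‖realFourier γ.g ξ‖ := by
          rw [← norm_mul, ← norm_mul]
          exact norm_sub_le _ _
      _ ≤ C * (k ^ (-s) * (1 + k) ^ 3) * ((2 * Real.pi) ^ 7 * Cf / (1 + k) ^ 7)
          + C * (k ^ (-s) * (1 + k) ^ 3) * ((2 * Real.pi) ^ 7 * Cg / (1 + k) ^ 7) :=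
          add_le_add (mul_le_mul (hb k hk) (key (hf ξ)) (norm_nonneg _) (by positivity))
            (mul_le_mul (hb' k hk) (key (hg ξ)) (norm_nonneg _) (by positivity))
      _ = _ := by
          have : (1 + k) ≠ 0 := by positivity
          field_simp

/-! ### Continuity and monotonicity of the entropy. -/

theorem continuous_gaussianEntropy : Continuous gaussianEntropy := by
  have h : Continuous fun x : ℝ => x * Real.logb 2 x := by
    have : (fun x : ℝ => x * Real.logb 2 x) = fun x => x * Real.log x / Real.log 2 := by
      funext x
      rw [Real.logb, mul_div_assoc]
    rw [this]
    exact Real.continuous_mul_log.div_const _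
  exact (h.comp (by fun_prop : Continuous fun ν : ℝ => (ν + 1) / 2)).sub
    (h.comp (by fun_prop : Continuous fun ν : ℝ => (ν - 1) / 2))

theorem hasDerivAt_gaussianEntropy {ν : ℝ} (h0 : ν + 1 ≠ 0) (h1 : ν - 1 ≠ 0) :
    HasDerivAt gaussianEntropy
      ((Real.log ((ν + 1) / 2) - Real.log ((ν - 1) / 2)) / (2 * Real.log 2)) ν := by
  have key : ∀ {x : ℝ}, x ≠ 0 →
      HasDerivAt (fun y => y * Real.logb 2 y) ((Real.log x + 1) / Real.log 2) x := by
    intro x hx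
    have := (Real.hasDerivAt_mul_log hx).div_const (Real.log 2)
    refine this.congr_of_eventuallyEq (Eventually.of_forall fun y => ?_)
    simp only [Real.logb]
    ring
  have k1 := (key (div_ne_zero h0 two_ne_zero)).comp ν
    (((hasDerivAt_id ν).add_const 1).div_const 2)
  have k2 := (key (div_ne_zero h1 two_ne_zero)).comp ν
    (((hasDerivAt_id ν).sub_const 1).div_const 2)
  refine (k1.sub k2).congr_deriv ?_
  have : Real.log 2 ≠ 0 := (Real.log_pos one_lt_two).ne'
  field_simp
  ring

/-- Since `Real.log` is `log |·|`, the derivative is nonnegative as soon as `|ν - 1| ≤ ν + 1`, which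
holds for all `ν ≥ 0`. Starting at `0` rather than `1` makes the uncertainty relation unnecessary.
-/
theorem monotoneOn_gaussianEntropy : MonotoneOn gaussianEntropy (Ici 0) := by
  have hd : ∀ ν : ℝ, 0 < ν → ν ≠ 1 → HasDerivAt gaussianEntropy
      ((Real.log ((ν + 1) / 2) - Real.log ((ν - 1) / 2)) / (2 * Real.log 2)) ν := fun ν h0 h1 =>
    hasDerivAt_gaussianEntropy (by linarith) (sub_ne_zero.2 h1)
  have hn : ∀ ν : ℝ, 0 < ν → ν ≠ 1 → 0 ≤ deriv gaussianEntropy ν := by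
    intro ν h0 h1
    rw [(hd ν h0 h1).deriv]
    have hl := Real.log_pos one_lt_two
    refine div_nonneg (sub_nonneg.2 ?_) (by positivity)
    rw [← Real.log_abs ((ν - 1) / 2)]
    have h2 : ν - 1 ≠ 0 := sub_ne_zero.2 h1
    refine Real.log_le_log (abs_pos.2 (by positivity)) ?_
    rw [abs_le]
    constructor <;> linarith
  have m1 : MonotoneOn gaussianEntropy (Icc 0 1) := by
    refine monotoneOn_of_deriv_nonneg (convex_Icc 0 1)
      continuous_gaussianEntropy.continuousOn ?_ ?_ <;> rw [interior_Icc]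
    · exact fun x hx => (hd x hx.1 hx.2.ne).differentiableAt.differentiableWithinAt
    · exact fun x hx => hn x hx.1 hx.2.ne
  have m2 : MonotoneOn gaussianEntropy (Ici 1) := by
    refine monotoneOn_of_deriv_nonneg (convex_Ici 1)
      continuous_gaussianEntropy.continuousOn ?_ ?_ <;> rw [interior_Ici]
    · exact fun x hx => (hd x (by linarith [mem_Ioi.1 hx])
        (ne_of_gt hx)).differentiableAt.differentiableWithinAt
    · exact fun x hx => hn x (by linarith [mem_Ioi.1 hx]) (ne_of_gt hx)
  have := m1.union_right m2 (c := 1) ⟨right_mem_Icc.2 zero_le_one, fun x hx => hx.2⟩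
    ⟨self_mem_Ici, fun x hx => hx⟩
  rwa [Icc_union_Ici_eq_Ici zero_le_one] at this

theorem entropy_le_entropy {u v : ℝ → ℝ → ℂ} {A : SingleMode}
    (h : (covariance u A).det ≤ (covariance v A).det) : entropy u A ≤ entropy v A :=
  monotoneOn_gaussianEntropy (Real.sqrt_nonneg _) (Real.sqrt_nonneg _) (Real.sqrt_le_sqrt h)

/-! ### Bounds on the index and square integrability in both vacua. -/

theorem bdIndex_eq {m H : ℝ} : bdIndex m H = Real.sqrt (9 / 4 - (m / H) ^ 2) := by
  rw [bdIndex, div_pow]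

theorem bdIndex_bounds {m H : ℝ} (hm : 0 < m) (hH : 0 < H) (h : m / H < 1) :
    1 < bdIndex m H ∧ bdIndex m H < 3 / 2 := by
  have h0 : 0 < m / H := by positivity
  rw [bdIndex_eq]
  constructor
  · rw [Real.lt_sqrt (by norm_num)]
    nlinarith
  · rw [Real.sqrt_lt' (by norm_num)]
    nlinarith [pow_pos h0 2]

/-- The deviation of the index from its massless value. -/
theorem three_halves_sub_bdIndex_le {m H : ℝ} (hm : 0 < m) (hH : 0 < H) (h : m / H < 1) :
    3 / 2 - bdIndex m H ≤ (m / H) ^ 2 := by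
  have h0 : 0 < m / H := by positivity
  have h1 := (bdIndex_bounds hm hH h).1
  have h2 : bdIndex m H ^ 2 = 9 / 4 - (m / H) ^ 2 := by
    rw [bdIndex_eq, Real.sq_sqrt]
    nlinarith
  -- Here `(3/2 - ν)(3/2 + ν) = m²/H²`, and the second factor exceeds `1`.
  nlinarith [(bdIndex_bounds hm hH h).2]

/-- The infrared singularity `k^{-(a+1/2)}` is square integrable in three dimensions because `a <
1`, that is, because the mass is positive. -/
theorem memLp_bunchDavies {m H a : ℝ} (hH : 0 < H) (ha : bdIndex m H = a + 1 / 2)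
    (ha0 : 1 / 2 < a) (ha1 : a < 1) (γ : PhasePoint) :
    MemLp (amplitude (bunchDaviesMode m H) γ) 2 := by
  obtain ⟨C₁, hC₁, h₁⟩ := exists_norm_hankelKernel_le (b := a) (by linarith) ha1.le
  obtain ⟨C₂, hC₂, h₂⟩ := exists_norm_hankelKernel_le (b := a - 1) (by linarith) (by linarith)
  have c₁ : ContinuousOn (fun k => hankelKernel a (k / H)) (Ioi 0) :=
    (continuousOn_hankelKernel (by linarith) ha1.le).comp (by fun_prop) fun k hk =>
      (div_pos hk hH).le
  have c₂ : ContinuousOn (fun k => hankelKernel (a - 1) (k / H)) (Ioi 0) :=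
    (continuousOn_hankelKernel (by linarith) (by linarith)).comp (by fun_prop) fun k hk =>
      (div_pos hk hH).le
  have c₃ : ContinuousOn (fun k : ℝ => ((H ^ a * k ^ (-(a + 1 / 2)) : ℝ) : ℂ)) (Ioi 0) := by
    intro k hk
    have hk' : (0 : ℝ) < k := hk
    refine ContinuousAt.continuousWithinAt
      (Complex.continuous_ofReal.continuousAt.comp (continuousAt_const.mul ?_))
    exact Real.continuousAt_rpow_const _ _ (Or.inl hk'.ne')
  have c₄ : ContinuousOn (fun k : ℝ => Complex.exp (Complex.I * (k / H : ℝ))) (Ioi 0) := by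
    fun_prop
  have nexp : ∀ k : ℝ, ‖Complex.exp (Complex.I * (k / H : ℝ))‖ = 1 := fun k => by
    rw [mul_comm, Complex.norm_exp_ofReal_mul_I]
  have npre : ∀ k : ℝ, 0 < k → ‖bdPrefactor a * (H ^ a * k ^ (-(a + 1 / 2)) : ℝ)‖
      = ‖bdPrefactor a‖ * H ^ a * k ^ (-(a + 1 / 2)) := fun k hk => by
    rw [norm_mul, Complex.norm_real, Real.norm_of_nonneg (by positivity), mul_assoc]
  set B := ‖bdPrefactor a‖ * H ^ a
  have hB : 0 ≤ B := by positivity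
  have hx : ∀ {C k : ℝ}, 0 ≤ C → 0 < k → C * (1 + k / H) ≤ C * (1 + 1 / H) * (1 + k) := by
    intro C k hC hk
    have : (1 + k / H) ≤ (1 + 1 / H) * (1 + k) := by
      have h1 : 0 < 1 / H := by positivity
      have h2 : k / H = k * (1 / H) := by ring
      nlinarith
    calc _ ≤ C * ((1 + 1 / H) * (1 + k)) := by gcongr
      _ = _ := by ring
  have pow_le : ∀ {k : ℝ}, 0 < k → 1 + k ≤ (1 + k) ^ 3 := fun hk =>
    le_self_pow₀ (by linarith) (by norm_num)
  refine memLp_amplitude (C := B * ((1 + H) * (C₁ * (1 + 1 / H)) + 1 / H * (C₂ * (1 + 1 / H))))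
    (s := a + 1 / 2) (by linarith) (by linarith) ?_ ?_ ?_ ?_ γ
  · refine ContinuousOn.congr ((continuousOn_const
      (c := bdPrefactor a).mul c₃).mul (c₄.mul c₁)) fun k hk => ?_
    exact bunchDaviesMode_zero hH hk ha
  · have c₅ : ContinuousOn (fun k : ℝ => ((k ^ 2 / H : ℝ) : ℂ)) (Ioi 0) := by fun_prop
    refine ContinuousOn.congr ((continuousOn_const (c := bdPrefactor a).mul c₃).mul (c₄.mul
      ((continuousOn_const (c := (((1 - a) * H : ℝ) : ℂ)).mul c₁).add
      (((continuousOn_const (c := Complex.I * (a : ℂ))).mul c₅).mul c₂)))).neg fun k hk => ?_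
    exact deriv_bunchDaviesMode hH hk ha ha0 ha1.le
  · intro k hk
    rw [bunchDaviesMode_zero hH hk ha, norm_mul, norm_mul (Complex.exp _), nexp, one_mul,
      npre k hk]
    have h3 := (h₁ (k / H) (by positivity)).trans (hx hC₁ hk)
    calc _ ≤ B * k ^ (-(a + 1 / 2)) * (C₁ * (1 + 1 / H) * (1 + k)) := by gcongr
      _ ≤ B * k ^ (-(a + 1 / 2)) * (C₁ * (1 + 1 / H) * (1 + k) ^ 3) := by
          gcongr
          exact pow_le hk
      _ = B * (C₁ * (1 + 1 / H)) * (k ^ (-(a + 1 / 2)) * (1 + k) ^ 3) := by ring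
      _ ≤ _ := by
          gcongr
          have : 0 ≤ H * (C₁ * (1 + 1 / H)) := by positivity
          have : 0 ≤ 1 / H * (C₂ * (1 + 1 / H)) := by positivity
          nlinarith
  · intro k hk
    rw [deriv_bunchDaviesMode hH hk ha ha0 ha1.le, norm_neg, norm_mul, norm_mul (Complex.exp _),
      nexp, one_mul, npre k hk]
    have h3 := (h₁ (k / H) (by positivity)).trans (hx hC₁ hk)
    have h4 := (h₂ (k / H) (by positivity)).trans (hx hC₂ hk)
    have h5 : ‖(((1 - a) * H : ℝ) : ℂ) * hankelKernel a (k / H)‖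
        ≤ (1 + H) * (C₁ * (1 + 1 / H)) * (1 + k) ^ 3 := by
      rw [norm_mul, Complex.norm_real,
        Real.norm_of_nonneg (mul_nonneg (by linarith) hH.le)]
      have : (1 - a) * H ≤ 1 + H := by nlinarith
      calc _ ≤ (1 + H) * (C₁ * (1 + 1 / H) * (1 + k)) := by gcongr
        _ ≤ (1 + H) * (C₁ * (1 + 1 / H) * (1 + k) ^ 3) := by
          gcongr
          exact pow_le hk
        _ = _ := by ring
    have h6 : ‖Complex.I * a * (k ^ 2 / H : ℝ) * hankelKernel (a - 1) (k / H)‖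
        ≤ 1 / H * (C₂ * (1 + 1 / H)) * (1 + k) ^ 3 := by
      rw [norm_mul, norm_mul, norm_mul, Complex.norm_I, one_mul, Complex.norm_real,
        Complex.norm_real, Real.norm_of_nonneg (by linarith), Real.norm_of_nonneg (by positivity)]
      have : k ^ 2 ≤ (1 + k) ^ 2 := by gcongr; linarith
      calc _ ≤ 1 * ((1 + k) ^ 2 / H) * (C₂ * (1 + 1 / H) * (1 + k)) := by gcongr
        _ = _ := by ring
    calc _ ≤ B * k ^ (-(a + 1 / 2)) * ((1 + H) * (C₁ * (1 + 1 / H)) * (1 + k) ^ 3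
          + 1 / H * (C₂ * (1 + 1 / H)) * (1 + k) ^ 3) := by
          gcongr
          exact (norm_add_le _ _).trans (add_le_add h5 h6)
      _ = _ := by ring

theorem memLp_minkowski (γ : PhasePoint) : MemLp (amplitude minkowskiMode γ) 2 := by
  have c : ContinuousOn (fun k : ℝ => (((Real.sqrt (2 * k))⁻¹ : ℝ) : ℂ)) (Ioi 0) := by
    refine Complex.continuous_ofReal.comp_continuousOn (ContinuousOn.inv₀ (by fun_prop) ?_)
    intro k hk
    have hk' : (0 : ℝ) < k := hk
    positivity
  have n : ∀ k : ℝ, 0 < k → ‖(((Real.sqrt (2 * k))⁻¹ : ℝ) : ℂ)‖ ≤ k ^ (-(1 / 2 : ℝ)) := by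
    intro k hk
    rw [Complex.norm_real, Real.norm_of_nonneg (by positivity), Real.rpow_neg hk.le,
      ← Real.sqrt_eq_rpow]
    gcongr
    linarith
  refine memLp_amplitude (C := 1) (s := 1 / 2) (by norm_num) (by norm_num) ?_ ?_ ?_ ?_ γ
  · simpa only [minkowskiMode_zero] using c
  · simp only [deriv_minkowskiMode]
    exact ((by fun_prop : ContinuousOn (fun k : ℝ => Complex.I * (k : ℂ)) (Ioi 0)).mul c).neg
  · intro k hk
    rw [minkowskiMode_zero, one_mul]
    exact (n k hk).trans (le_mul_of_one_le_right (by positivity) (one_le_pow₀ (by linarith)))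
  · intro k hk
    rw [deriv_minkowskiMode, norm_neg, norm_mul, norm_mul, Complex.norm_I, one_mul,
      Complex.norm_real, Real.norm_of_nonneg hk.le, one_mul, mul_comm]
    gcongr
    · exact n k hk
    · calc k ≤ (1 + k) ^ 1 := by linarith
        _ ≤ (1 + k) ^ 3 := pow_le_pow_right₀ (by linarith) (by norm_num)

/-! ### Lower bounds for the Bunch-Davies determinant from pointwise limits. -/

/-- `reducedAmplitude` for a labelled observable. -/
def modeAmplitude (a H : ℝ) (γ : PhasePoint) (ξ : Space) : ℂ :=
  reducedAmplitude a H (2 * Real.pi * ‖ξ‖) (realFourier γ.f ξ) (realFourier γ.g ξ)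

theorem aestronglyMeasurable_modeAmplitude {a H : ℝ} (hH : 0 < H) (ha0 : 1 / 2 < a) (ha1 : a ≤ 1)
    (γ : PhasePoint) : AEStronglyMeasurable (modeAmplitude a H γ) := by
  have c₁ : Continuous fun ξ : Space => hankelKernel a (2 * Real.pi * ‖ξ‖ / H) :=
    (continuousOn_hankelKernel (by linarith) ha1).comp_continuous (by fun_prop) fun ξ => by
      simp only [mem_Ici]; positivity
  have c₂ : Continuous fun ξ : Space => hankelKernel (a - 1) (2 * Real.pi * ‖ξ‖ / H) :=
    (continuousOn_hankelKernel (by linarith) (by linarith)).comp_continuous (by fun_prop) fun ξ => by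
      simp only [mem_Ici]; positivity
  have c₃ := γ.isTestFunction_f.continuous_realFourier
  have c₄ := γ.isTestFunction_g.continuous_realFourier
  have c₅ : Measurable fun ξ : Space => (((2 * Real.pi * ‖ξ‖) ^ (-(a + 1 / 2))
      / (Real.sqrt 2 * Real.Gamma (a + 1)) : ℝ) : ℂ) := by fun_prop
  unfold modeAmplitude reducedAmplitude
  refine AEStronglyMeasurable.mul c₅.aestronglyMeasurable (Continuous.aestronglyMeasurable ?_)
  fun_prop

/-- The phases drop out, and a factor `H^a` on each of the two observables becomes `H^{4a}`. -/
theorem ofReal_det_bunchDavies {m H a : ℝ} (hH : 0 < H) (ha : bdIndex m H = a + 1 / 2)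
    (ha0 : 1 / 2 < a) (ha1 : a < 1) (A : SingleMode) :
    ENNReal.ofReal (covariance (bunchDaviesMode m H) A).det
      = ENNReal.ofReal (2 * H ^ (4 * a))
        * gramIntegral volume (modeAmplitude a H (A.γ 0)) (modeAmplitude a H (A.γ 1)) := by
  rw [ofReal_det_covariance fun i => memLp_bunchDavies hH ha ha0 ha1 _]
  have h1 : gramIntegral volume (amplitude (bunchDaviesMode m H) (A.γ 0))
      (amplitude (bunchDaviesMode m H) (A.γ 1))
      = gramIntegral volume
        (fun ξ => ((H ^ a : ℝ) : ℂ) * modeAmplitude a H (A.γ 0) ξ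
          + ((0 : ℝ) : ℂ) * modeAmplitude a H (A.γ 1) ξ)
        (fun ξ => ((0 : ℝ) : ℂ) * modeAmplitude a H (A.γ 0) ξ
          + ((H ^ a : ℝ) : ℂ) * modeAmplitude a H (A.γ 1) ξ) := by
    refine gramIntegral_congr_phase ?_
    filter_upwards [ae_ne_zero] with ξ hξ
    obtain ⟨φ, hφ, h⟩ := exists_phase_bunchDavies hH (two_pi_norm_pos hξ) ha ha0 ha1.le
    refine ⟨φ, hφ, ?_, ?_⟩
    · rw [amplitude_eq, h, modeAmplitude, Complex.ofReal_zero, zero_mul, add_zero]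
    · rw [amplitude_eq, h, modeAmplitude, Complex.ofReal_zero, zero_mul, zero_add]
      rfl
  have h2 : (H ^ a * H ^ a - 0 * 0) ^ 2 = H ^ (4 * a) := by
    rw [mul_zero, sub_zero, ← Real.rpow_add hH, ← Real.rpow_natCast, ← Real.rpow_mul hH.le]
    norm_num
    ring_nf
  rw [h1, gramIntegral_linear, h2, ENNReal.ofReal_mul (by norm_num), ENNReal.ofReal_ofNat,
    mul_assoc]

/-- Asymptotic lower bound for the Bunch-Davies determinant, by real linear combinations of the
amplitudes that converge pointwise. -/
theorem eventually_lt_det {A : SingleMode} {m H a c₁₁ c₁₂ c₂₁ c₂₂ : ℕ → ℝ} (hH : ∀ n, 0 < H n)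
    (ha : ∀ n, bdIndex (m n) (H n) = a n + 1 / 2) (ha0 : ∀ n, 1 / 2 < a n) (ha1 : ∀ n, a n < 1)
    {V₁ V₂ : Space → ℂ}
    (h₁ : ∀ ξ, ξ ≠ 0 → Tendsto (fun n => c₁₁ n * modeAmplitude (a n) (H n) (A.γ 0) ξ
      + c₁₂ n * modeAmplitude (a n) (H n) (A.γ 1) ξ) atTop (𝓝 (V₁ ξ)))
    (h₂ : ∀ ξ, ξ ≠ 0 → Tendsto (fun n => c₂₁ n * modeAmplitude (a n) (H n) (A.γ 0) ξ
      + c₂₂ n * modeAmplitude (a n) (H n) (A.γ 1) ξ) atTop (𝓝 (V₂ ξ)))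
    {c : ℝ} (hc : ENNReal.ofReal c < gramIntegral volume V₁ V₂) :
    ∀ᶠ n in atTop, c < (c₁₁ n * c₂₂ n - c₁₂ n * c₂₁ n) ^ 2 / (2 * H n ^ (4 * a n))
      * (covariance (bunchDaviesMode (m n) (H n)) A).det := by
  have ms : ∀ n i, AEStronglyMeasurable (modeAmplitude (a n) (H n) (A.γ i)) := fun n i =>
    aestronglyMeasurable_modeAmplitude (hH n) (ha0 n) (ha1 n).le _
  have hF := gramIntegral_le_liminf (μ := volume) (V₁ := V₁) (V₂ := V₂)
    (fun n => (((ms n 0).const_mul (c₁₁ n : ℂ)).add ((ms n 1).const_mul (c₁₂ n : ℂ))))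
    (fun n => (((ms n 0).const_mul (c₂₁ n : ℂ)).add ((ms n 1).const_mul (c₂₂ n : ℂ))))
    (ae_ne_zero.mono h₁) (ae_ne_zero.mono h₂)
  filter_upwards [eventually_lt_of_lt_liminf (lt_of_lt_of_le hc hF)] with n hn
  have e := gramIntegral_linear (μ := volume) (c₁₁ n) (c₁₂ n) (c₂₁ n) (c₂₂ n)
    (modeAmplitude (a n) (H n) (A.γ 0)) (modeAmplitude (a n) (H n) (A.γ 1))
  have hn' := lt_of_lt_of_eq hn e
  have hpos : 0 < 2 * H n ^ (4 * a n) := by have := hH n; positivity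
  have e2 : gramIntegral volume (modeAmplitude (a n) (H n) (A.γ 0))
      (modeAmplitude (a n) (H n) (A.γ 1)) = ENNReal.ofReal ((2 * H n ^ (4 * a n))⁻¹
        * (covariance (bunchDaviesMode (m n) (H n)) A).det) := by
    rw [ENNReal.ofReal_mul (by positivity), ofReal_det_bunchDavies (hH n) (ha n) (ha0 n) (ha1 n),
      ← mul_assoc, ← ENNReal.ofReal_mul (by positivity), inv_mul_cancel₀ hpos.ne',
      ENNReal.ofReal_one, one_mul]
  rw [e2, ← ENNReal.ofReal_mul (sq_nonneg _), ← mul_assoc, ← div_eq_mul_inv] at hn'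
  exact (ENNReal.ofReal_lt_ofReal_iff'.1 hn').1

/-- If the combinations have linearly independent limits and degenerate as maps, compared with the
overall normalization of the amplitudes, then the Bunch-Davies determinant diverges. -/
theorem eventually_le_det {A : SingleMode} {m H a c₁₁ c₁₂ c₂₁ c₂₂ : ℕ → ℝ} (hH : ∀ n, 0 < H n)
    (ha : ∀ n, bdIndex (m n) (H n) = a n + 1 / 2) (ha0 : ∀ n, 1 / 2 < a n) (ha1 : ∀ n, a n < 1)
    {V₁ V₂ : Space → ℂ}
    (h₁ : ∀ ξ, ξ ≠ 0 → Tendsto (fun n => c₁₁ n * modeAmplitude (a n) (H n) (A.γ 0) ξ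
      + c₁₂ n * modeAmplitude (a n) (H n) (A.γ 1) ξ) atTop (𝓝 (V₁ ξ)))
    (h₂ : ∀ ξ, ξ ≠ 0 → Tendsto (fun n => c₂₁ n * modeAmplitude (a n) (H n) (A.γ 0) ξ
      + c₂₂ n * modeAmplitude (a n) (H n) (A.γ 1) ξ) atTop (𝓝 (V₂ ξ)))
    (hV : gramIntegral volume V₁ V₂ ≠ 0)
    (hdet : Tendsto (fun n => (c₁₁ n * c₂₂ n - c₁₂ n * c₂₁ n) ^ 2 / (2 * H n ^ (4 * a n)))
      atTop (𝓝 0)) (B : ℝ) :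
    ∀ᶠ n in atTop, B ≤ (covariance (bunchDaviesMode (m n) (H n)) A).det := by
  obtain ⟨c, hc0, hc⟩ : ∃ c : ℝ, 0 < c ∧ ENNReal.ofReal c < gramIntegral volume V₁ V₂ := by
    obtain ⟨r, hr0, hr⟩ := ENNReal.lt_iff_exists_nnreal_btwn.1 (pos_iff_ne_zero.2 hV)
    refine ⟨r, by exact_mod_cast hr0, by simpa using hr⟩
  have hs : Tendsto (fun n => (c₁₁ n * c₂₂ n - c₁₂ n * c₂₁ n) ^ 2 / (2 * H n ^ (4 * a n)) * B)
      atTop (𝓝 0) := by simpa using hdet.mul_const B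
  filter_upwards [eventually_lt_det hH ha ha0 ha1 h₁ h₂ hc, hs.eventually_lt_const hc0]
    with n h3 h4
  by_contra! h5
  have h6 : 0 ≤ (c₁₁ n * c₂₂ n - c₁₂ n * c₂₁ n) ^ 2 / (2 * H n ^ (4 * a n)) := by
    have := hH n
    positivity
  have := mul_le_mul_of_nonneg_left h5.le h6
  linarith

/-- The coefficients may themselves vary and grow with `n`; only the two combinations that enter the
amplitude have to converge. -/
theorem tendsto_reducedAmplitude {a H : ℕ → ℝ} {F G : ℕ → ℂ} {k a₀ x₀ : ℝ} {P Q : ℂ} (hk : 0 < k)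
    (hH : ∀ n, 0 < H n) (ha₀ : 1 / 2 < a₀) (ha : Tendsto a atTop (𝓝 a₀)) (ha1 : ∀ n, a n < 1)
    (hx : Tendsto (fun n => k / H n) atTop (𝓝 x₀))
    (hP : Tendsto (fun n => F n + ((1 - a n) * H n : ℝ) * G n) atTop (𝓝 P))
    (hQ : Tendsto (fun n => ((H n)⁻¹ : ℝ) * G n) atTop (𝓝 Q)) :
    Tendsto (fun n => reducedAmplitude (a n) (H n) k (F n) (G n)) atTop
      (𝓝 (((k ^ (-(a₀ + 1 / 2)) / (Real.sqrt 2 * Real.Gamma (a₀ + 1)) : ℝ) : ℂ)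
        * (hankelKernel a₀ x₀ * P
          + Complex.I * a₀ * (k ^ 2 : ℝ) * hankelKernel (a₀ - 1) x₀ * Q))) := by
  have hx0 : ∀ᶠ n in atTop, 0 ≤ k / H n := Eventually.of_forall fun n => (div_pos hk (hH n)).le
  have k1 := tendsto_hankelKernel (by linarith) ha (Eventually.of_forall fun n => (ha1 n).le) hx hx0
  have k2 := tendsto_hankelKernel (b₀ := a₀ - 1) (by linarith) (ha.sub_const 1)
    (Eventually.of_forall fun n => by linarith [ha1 n]) hx hx0
  have haC : Tendsto (fun n => ((a n : ℝ) : ℂ)) atTop (𝓝 (a₀ : ℂ)) :=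
    (Complex.continuous_ofReal.tendsto _).comp ha
  have hN : Tendsto (fun n => ((k ^ (-(a n + 1 / 2))
      / (Real.sqrt 2 * Real.Gamma (a n + 1)) : ℝ) : ℂ)) atTop
      (𝓝 ((k ^ (-(a₀ + 1 / 2)) / (Real.sqrt 2 * Real.Gamma (a₀ + 1)) : ℝ) : ℂ)) := by
    refine (Complex.continuous_ofReal.tendsto _).comp (Tendsto.div ?_ ?_ ?_)
    · exact tendsto_const_nhds.rpow (ha.add_const _).neg (Or.inl hk.ne')
    · have hc : ContinuousAt Real.Gamma (a₀ + 1) := by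
        refine (Real.differentiableAt_Gamma fun j => ?_).continuousAt
        have : (0 : ℝ) ≤ j := j.cast_nonneg
        linarith
      exact tendsto_const_nhds.mul (hc.tendsto.comp (ha.add_const 1))
    · have := Real.Gamma_pos_of_pos (s := a₀ + 1) (by linarith)
      positivity
  refine (hN.mul ((k1.mul hP).add ((((haC.const_mul Complex.I).mul_const
    ((k ^ 2 : ℝ) : ℂ)).mul k2).mul hQ))).congr fun n => ?_
  have : (H n : ℂ) ≠ 0 := by exact_mod_cast (hH n).ne'
  simp only [reducedAmplitude]
  push_cast
  field_simp

/-- The pointwise limit of rescaled Bunch-Davies amplitudes at small `k/H`. -/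
def limitAmplitude (a : ℝ) (P Q : Space → ℂ) (ξ : Space) : ℂ :=
  (((2 * Real.pi * ‖ξ‖) ^ (-(a + 1 / 2)) / (Real.sqrt 2 * Real.Gamma (a + 1)) : ℝ) : ℂ)
    * (hankelKernel a 0 * P ξ
      + Complex.I * a * ((2 * Real.pi * ‖ξ‖) ^ 2 : ℝ) * hankelKernel (a - 1) 0 * Q ξ)

theorem aestronglyMeasurable_limitAmplitude (a : ℝ) {P Q : Space → ℂ} (hP : Continuous P)
    (hQ : Continuous Q) : AEStronglyMeasurable (limitAmplitude a P Q) := by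
  have c : Measurable fun ξ : Space => (((2 * Real.pi * ‖ξ‖) ^ (-(a + 1 / 2))
      / (Real.sqrt 2 * Real.Gamma (a + 1)) : ℝ) : ℂ) := by fun_prop
  refine AEStronglyMeasurable.mul c.aestronglyMeasurable (Continuous.aestronglyMeasurable ?_)
  fun_prop

theorem eq_zero_of_ae_eq_zero {φ : Space → ℂ} (hφ : Continuous φ) (h : ∀ᵐ ξ, φ ξ = 0) (ξ : Space) :
    φ ξ = 0 :=
  congrFun ((Continuous.ae_eq_iff_eq volume hφ continuous_const (g := fun _ => (0 : ℂ))).1 h) ξ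

theorem exists_relation_of_limitAmplitude {a : ℝ} (ha : 0 < a) {P₁ Q₁ P₂ Q₂ : Space → ℂ}
    (hP₁ : Continuous P₁) (hQ₁ : Continuous Q₁) (hP₂ : Continuous P₂) (hQ₂ : Continuous Q₂)
    (h : gramIntegral volume (limitAmplitude a P₁ Q₁) (limitAmplitude a P₂ Q₂) = 0) :
    ∃ c d : ℝ, (c ≠ 0 ∨ d ≠ 0) ∧ ∀ ξ, hankelKernel a 0 * (c * P₁ ξ + d * P₂ ξ)
      + Complex.I * a * ((2 * Real.pi * ‖ξ‖) ^ 2 : ℝ) * hankelKernel (a - 1) 0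
        * (c * Q₁ ξ + d * Q₂ ξ) = 0 := by
  obtain ⟨c, d, hcd, hr⟩ := exists_relation_of_gramIntegral_eq_zero
    (aestronglyMeasurable_limitAmplitude a hP₁ hQ₁)
    (aestronglyMeasurable_limitAmplitude a hP₂ hQ₂) h
  refine ⟨c, d, hcd, eq_zero_of_ae_eq_zero (by fun_prop) ?_⟩
  filter_upwards [hr, ae_ne_zero] with ξ h1 h2
  have hk := two_pi_norm_pos h2
  have hG := Real.Gamma_pos_of_pos (s := a + 1) (by linarith)
  have hN : (((2 * Real.pi * ‖ξ‖) ^ (-(a + 1 / 2)) / (Real.sqrt 2 * Real.Gamma (a + 1)) : ℝ) : ℂ)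
      ≠ 0 := by
    rw [Complex.ofReal_ne_zero]
    positivity
  refine (mul_eq_zero.1 (Eq.trans ?_ h1)).resolve_left hN
  simp only [limitAmplitude]
  ring

/-- Divergence of the Bunch-Davies determinant from independent infrared limits. -/
theorem eventually_le_det_of_limits {A : SingleMode} {m H a c₁₁ c₁₂ c₂₁ c₂₂ : ℕ → ℝ} {a₀ : ℝ}
    (hH : ∀ n, 0 < H n) (ha : ∀ n, bdIndex (m n) (H n) = a n + 1 / 2) (ha0 : ∀ n, 1 / 2 < a n)
    (ha1 : ∀ n, a n < 1) (ha₀ : 1 / 2 < a₀) (hlim : Tendsto a atTop (𝓝 a₀))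
    (hHinf : Tendsto H atTop atTop) {P₁ Q₁ P₂ Q₂ : Space → ℂ}
    (hP₁ : Continuous P₁) (hQ₁ : Continuous Q₁) (hP₂ : Continuous P₂) (hQ₂ : Continuous Q₂)
    (h₁ : ∀ ξ, Tendsto (fun n => (c₁₁ n * realFourier (A.γ 0).f ξ + c₁₂ n * realFourier (A.γ 1).f ξ)
      + ((1 - a n) * H n : ℝ) * (c₁₁ n * realFourier (A.γ 0).g ξ + c₁₂ n * realFourier (A.γ 1).g ξ))
      atTop (𝓝 (P₁ ξ)))
    (h₁' : ∀ ξ, Tendsto (fun n => ((H n)⁻¹ : ℝ) * (c₁₁ n * realFourier (A.γ 0).g ξ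
      + c₁₂ n * realFourier (A.γ 1).g ξ)) atTop (𝓝 (Q₁ ξ)))
    (h₂ : ∀ ξ, Tendsto (fun n => (c₂₁ n * realFourier (A.γ 0).f ξ + c₂₂ n * realFourier (A.γ 1).f ξ)
      + ((1 - a n) * H n : ℝ) * (c₂₁ n * realFourier (A.γ 0).g ξ + c₂₂ n * realFourier (A.γ 1).g ξ))
      atTop (𝓝 (P₂ ξ)))
    (h₂' : ∀ ξ, Tendsto (fun n => ((H n)⁻¹ : ℝ) * (c₂₁ n * realFourier (A.γ 0).g ξ
      + c₂₂ n * realFourier (A.γ 1).g ξ)) atTop (𝓝 (Q₂ ξ)))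
    {D : ℝ} (hD : ∀ᶠ n in atTop, |c₁₁ n * c₂₂ n - c₁₂ n * c₂₁ n| ≤ D * H n)
    (hrel : ∀ c d : ℝ, (c ≠ 0 ∨ d ≠ 0) → ¬ ∀ ξ, hankelKernel a₀ 0 * (c * P₁ ξ + d * P₂ ξ)
      + Complex.I * a₀ * ((2 * Real.pi * ‖ξ‖) ^ 2 : ℝ) * hankelKernel (a₀ - 1) 0
        * (c * Q₁ ξ + d * Q₂ ξ) = 0) (B : ℝ) :
    ∀ᶠ n in atTop, B ≤ (covariance (bunchDaviesMode (m n) (H n)) A).det := by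
  have lim : ∀ {c₁ c₂ : ℕ → ℝ} {P Q : Space → ℂ},
      (∀ ξ, Tendsto (fun n => (c₁ n * realFourier (A.γ 0).f ξ + c₂ n * realFourier (A.γ 1).f ξ)
        + ((1 - a n) * H n : ℝ) * (c₁ n * realFourier (A.γ 0).g ξ
          + c₂ n * realFourier (A.γ 1).g ξ)) atTop (𝓝 (P ξ))) →
      (∀ ξ, Tendsto (fun n => ((H n)⁻¹ : ℝ) * (c₁ n * realFourier (A.γ 0).g ξ
        + c₂ n * realFourier (A.γ 1).g ξ)) atTop (𝓝 (Q ξ))) →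
      ∀ ξ, ξ ≠ 0 → Tendsto (fun n => c₁ n * modeAmplitude (a n) (H n) (A.γ 0) ξ
        + c₂ n * modeAmplitude (a n) (H n) (A.γ 1) ξ) atTop (𝓝 (limitAmplitude a₀ P Q ξ)) := by
    intro c₁ c₂ P Q h h' ξ hξ
    refine (tendsto_reducedAmplitude (two_pi_norm_pos hξ) hH ha₀ hlim ha1
      (hHinf.const_div_atTop _) (h ξ) (h' ξ)).congr fun n => ?_
    rw [modeAmplitude, modeAmplitude, reducedAmplitude_linear]
  refine eventually_le_det hH ha ha0 ha1 (lim h₁ h₁') (lim h₂ h₂') ?_ ?_ B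
  · intro h0
    obtain ⟨c, d, hcd, hr⟩ :=
      exists_relation_of_limitAmplitude (by linarith) hP₁ hQ₁ hP₂ hQ₂ h0
    exact hrel c d hcd hr
  -- The exponent `b` lies strictly between `1/2` and `a₀`, so `4b > 2` and `H^{4a}` eventually
  -- dominates the squared coefficient determinant `D² H²`.
  · set b := (a₀ + 1 / 2) / 2 with hb
    have t1 : Tendsto (fun n => D ^ 2 / 2 * H n ^ (-(4 * b - 2))) atTop (𝓝 0) := by
      simpa using ((tendsto_rpow_neg_atTop (show 0 < 4 * b - 2 by rw [hb]; linarith)).comp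
        hHinf).const_mul (D ^ 2 / 2)
    refine squeeze_zero' (Eventually.of_forall fun n => ?_) ?_ t1
    · have := hH n
      positivity
    · filter_upwards [hD, hHinf.eventually_ge_atTop 1,
        Tendsto.eventually_const_le (show b < a₀ by rw [hb]; linarith) hlim] with n h3 h4 h5
      have hHn := hH n
      have h6 : (c₁₁ n * c₂₂ n - c₁₂ n * c₂₁ n) ^ 2 ≤ (D * H n) ^ 2 := sq_le_sq' (by
        linarith [neg_abs_le (c₁₁ n * c₂₂ n - c₁₂ n * c₂₁ n)]) ((le_abs_self _).trans h3)
      have h7 : H n ^ (4 * b) ≤ H n ^ (4 * a n) :=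
        Real.rpow_le_rpow_of_exponent_le h4 (by linarith)
      calc _ ≤ (D * H n) ^ 2 / (2 * H n ^ (4 * b)) := by gcongr
        _ = _ := by
          rw [neg_sub, Real.rpow_sub hHn, Real.rpow_two]
          field_simp

/-! ### Independence of the observables and auxiliary algebra. -/

/-- The two observables of a mode are linearly independent. -/
theorem SingleMode.not_dependent (A : SingleMode) {a b : ℝ} (hab : a ≠ 0 ∨ b ≠ 0)
    (hg : ∀ x, a * (A.γ 0).g x + b * (A.γ 1).g x = 0)
    (hf : ∀ x, a * (A.γ 0).f x + b * (A.γ 1).f x = 0) : False := by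
  have h : ∀ x, (A.γ 0).g x * (A.γ 1).f x - (A.γ 0).f x * (A.γ 1).g x = 0 := by
    intro x
    rcases hab with h | h
    · refine (mul_eq_zero.1 (?_ : a * _ = 0)).resolve_left h
      linear_combination (A.γ 1).f x * hg x - (A.γ 1).g x * hf x
    · refine (mul_eq_zero.1 (?_ : b * _ = 0)).resolve_left h
      linear_combination (A.γ 0).g x * hf x - (A.γ 0).f x * hg x
  have := A.canonical
  simp [commutatorForm, h] at this

theorem IsTestFunction.relation {h₁ h₂ : Space → ℝ} (t₁ : IsTestFunction h₁)
    (t₂ : IsTestFunction h₂) {a b : ℝ}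
    (h : ∀ ξ, a * realFourier h₁ ξ + b * realFourier h₂ ξ = 0) (x : Space) :
    a * h₁ x + b * h₂ x = 0 :=
  (t₁.linear t₂ a b).eq_zero_of_realFourier
    (fun ξ => (t₁.realFourier_linear t₂ a b ξ).trans (h ξ)) x

theorem SingleMode.not_dependent_fourier (A : SingleMode) {a b : ℝ} (hab : a ≠ 0 ∨ b ≠ 0)
    (hg : ∀ ξ, a * realFourier (A.γ 0).g ξ + b * realFourier (A.γ 1).g ξ = 0)
    (hf : ∀ ξ, a * realFourier (A.γ 0).f ξ + b * realFourier (A.γ 1).f ξ = 0) : False :=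
  A.not_dependent hab
    ((A.γ 0).isTestFunction_g.relation (A.γ 1).isTestFunction_g hg)
    ((A.γ 0).isTestFunction_f.relation (A.γ 1).isTestFunction_f hf)

/-- A planar rotation with scaling has trivial kernel. -/
theorem eq_zero_of_rotation {a b : ℝ} (hab : a ≠ 0 ∨ b ≠ 0) {z w : ℂ} (h₁ : a * z + b * w = 0)
    (h₂ : -b * z + a * w = 0) : z = 0 ∧ w = 0 := by
  have hn : ((a ^ 2 + b ^ 2 : ℝ) : ℂ) ≠ 0 := by
    rw [Complex.ofReal_ne_zero]
    rcases hab with h | h <;> positivity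
  push_cast at hn
  constructor
  · refine (mul_eq_zero.1 (?_ : ((a : ℂ) ^ 2 + b ^ 2) * z = 0)).resolve_left hn
    linear_combination a * h₁ - b * h₂
  · refine (mul_eq_zero.1 (?_ : ((a : ℂ) ^ 2 + b ^ 2) * w = 0)).resolve_left hn
    linear_combination b * h₁ + a * h₂

/-- A quadratic polynomial in the momentum kills no nonzero continuous function. -/
theorem eq_zero_of_quadratic_mul {φ : Space → ℂ} (hφ : Continuous φ) {α β : ℂ}
    (h0 : α ≠ 0 ∨ β ≠ 0)
    (h : ∀ ξ : Space, (α + β * ((2 * Real.pi * ‖ξ‖) ^ 2 : ℝ)) * φ ξ = 0) (ξ : Space) :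
    φ ξ = 0 := by
  by_cases hβ : β = 0
  · have hα : α ≠ 0 := h0.resolve_right (not_not.2 hβ)
    have := h ξ
    rw [hβ, zero_mul, add_zero] at this
    exact (mul_eq_zero.1 this).resolve_left hα
  · refine eq_zero_of_ae_eq_zero hφ ?_ ξ
    -- All zeros of the quadratic factor lie on this one sphere, a null set.
    have hs : ∀ᵐ ξ : Space, ‖ξ‖ ≠ Real.sqrt ‖α / β‖ / (2 * Real.pi) := by
      have := Measure.addHaar_sphere (volume : Measure Space) 0 (Real.sqrt ‖α / β‖ / (2 * Real.pi))
      rw [ae_iff]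
      refine Eq.trans ?_ this
      congr 1
      ext ξ
      simp
    filter_upwards [hs] with η hη
    refine (mul_eq_zero.1 (h η)).resolve_left fun h1 => hη ?_
    have h2 : α / β = -((2 * Real.pi * ‖η‖) ^ 2 : ℝ) := by
      rw [div_eq_iff hβ]
      linear_combination h1
    rw [h2, norm_neg, Complex.norm_real, Real.norm_of_nonneg (by positivity),
      Real.sqrt_sq (by positivity)]
    field_simp

theorem abs_const_le_mul {D : ℝ} (hD : 0 ≤ D) {H : ℕ → ℝ} (hHinf : Tendsto H atTop atTop) :
    ∀ᶠ n in atTop, D ≤ D * H n := by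
  filter_upwards [hHinf.eventually_ge_atTop 1] with n hn
  exact le_mul_of_one_le_right hD hn

/-! ### Fixed ratio of mass to Hubble rate. -/

/-- At a fixed ratio `m/H`, the determinant of every mode diverges as `H → ∞`. -/
theorem eventually_le_det_of_fixed_index (A : SingleMode) {m H : ℕ → ℝ} {a : ℝ}
    (hH : ∀ n, 0 < H n) (ha : ∀ n, bdIndex (m n) (H n) = a + 1 / 2) (ha0 : 1 / 2 < a)
    (ha1 : a < 1) (hHinf : Tendsto H atTop atTop) (B : ℝ) :
    ∀ᶠ n in atTop, B ≤ (covariance (bunchDaviesMode (m n) (H n)) A).det := by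
  have cf := fun i => (A.γ i).isTestFunction_f.continuous_realFourier
  have cg := fun i => (A.γ i).isTestFunction_g.continuous_realFourier
  have cf0 := cf 0
  have cf1 := cf 1
  have cg0 := cg 0
  have cg1 := cg 1
  have hHC : ∀ n, (H n : ℂ) ≠ 0 := fun n => by exact_mod_cast (hH n).ne'
  have hinv : Tendsto (fun n => (((H n)⁻¹ : ℝ) : ℂ)) atTop (𝓝 0) := by
    have := (Complex.continuous_ofReal.tendsto 0).comp (tendsto_inv_atTop_zero.comp hHinf)
    rwa [Complex.ofReal_zero] at this
  have hlin : ∀ X Y : ℂ, Tendsto (fun n => Y + (((H n)⁻¹ : ℝ) : ℂ) * X) atTop (𝓝 Y) := by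
    intro X Y
    simpa using (hinv.mul_const X).const_add Y
  have hK := hankelKernel_zero_right_ne_zero (b := a) (by linarith)
  have hK' := hankelKernel_zero_right_ne_zero (b := a - 1) (by linarith)
  have haC : (1 - a : ℂ) ≠ 0 := by
    have : ((1 - a : ℝ) : ℂ) ≠ 0 := by
      rw [Complex.ofReal_ne_zero]
      linarith
    push_cast at this
    exact this
  have main := fun {c₁₁ c₁₂ c₂₁ c₂₂ : ℕ → ℝ} {P₁ Q₁ P₂ Q₂ : Space → ℂ} h1 h2 h3 h4 h5 h6 h7 h8
      {D : ℝ} h9 h10 => eventually_le_det_of_limits (A := A) (c₁₁ := c₁₁) (c₁₂ := c₁₂)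
    (c₂₁ := c₂₁) (c₂₂ := c₂₂) (P₁ := P₁) (Q₁ := Q₁) (P₂ := P₂) (Q₂ := Q₂) (D := D) hH ha
    (fun _ => ha0) (fun _ => ha1) ha0 tendsto_const_nhds hHinf h1 h2 h3 h4 h5 h6 h7 h8 h9 h10 B
  -- The leading term is `(1 - a) H G`. If no combination of the two `g` vanishes, dividing both
  -- observables by `H` gives independent limits.
  by_cases hg : ∃ α β : ℝ, (α ≠ 0 ∨ β ≠ 0) ∧
      ∀ ξ, α * realFourier (A.γ 0).g ξ + β * realFourier (A.γ 1).g ξ = 0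
  swap
  · refine main (c₁₁ := fun n => (H n)⁻¹) (c₁₂ := fun _ => 0) (c₂₁ := fun _ => 0)
      (c₂₂ := fun n => (H n)⁻¹) (P₁ := fun ξ => (1 - a) * realFourier (A.γ 0).g ξ)
      (Q₁ := fun _ => 0) (P₂ := fun ξ => (1 - a) * realFourier (A.γ 1).g ξ) (Q₂ := fun _ => 0)
      (D := 1) (by fun_prop) (by fun_prop) (by fun_prop) (by fun_prop) (fun ξ => ?_) (fun ξ => ?_)
      (fun ξ => ?_) (fun ξ => ?_) ?_ ?_
    · refine (hlin (realFourier (A.γ 0).f ξ) _).congr fun n => ?_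
      have := hHC n
      push_cast
      field_simp
      ring
    · have := hinv.mul (hinv.mul_const (realFourier (A.γ 0).g ξ))
      simpa using this
    · refine (hlin (realFourier (A.γ 1).f ξ) _).congr fun n => ?_
      have := hHC n
      push_cast
      field_simp
      ring
    · have := hinv.mul (hinv.mul_const (realFourier (A.γ 1).g ξ))
      simpa using this
    · filter_upwards [hHinf.eventually_ge_atTop 1] with n hn
      have h1 : (H n)⁻¹ ≤ 1 := inv_le_one_of_one_le₀ hn
      have h0 : 0 < (H n)⁻¹ := inv_pos.2 (hH n)
      rw [mul_zero, sub_zero, abs_of_pos (by positivity)]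
      nlinarith
    · intro c d hcd hr
      refine hg ⟨c, d, hcd, fun ξ => ?_⟩
      refine (mul_eq_zero.1 (Eq.trans ?_ (hr ξ))).resolve_left (mul_ne_zero hK haC)
      ring
  obtain ⟨α, β, hαβ, hg⟩ := hg
  have hF : ¬ ∀ ξ, α * realFourier (A.γ 0).f ξ + β * realFourier (A.γ 1).f ξ = 0 :=
    fun h => A.not_dependent_fourier hαβ hg h
  -- The combination `(α, β)` is now of pure field type and is kept as it is. Its rotated partner
  -- `(-β, α)` grows like `H` and is divided by `H`, which works unless its `g`-part is a multiple
  -- of the first `f`-part.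
  by_cases hc : ∃ c : ℝ, ∀ ξ, -β * realFourier (A.γ 0).g ξ + α * realFourier (A.γ 1).g ξ
      = c * (α * realFourier (A.γ 0).f ξ + β * realFourier (A.γ 1).f ξ)
  swap
  · refine main (c₁₁ := fun _ => α) (c₁₂ := fun _ => β) (c₂₁ := fun n => -β * (H n)⁻¹)
      (c₂₂ := fun n => α * (H n)⁻¹)
      (P₁ := fun ξ => α * realFourier (A.γ 0).f ξ + β * realFourier (A.γ 1).f ξ)
      (Q₁ := fun _ => 0)
      (P₂ := fun ξ => (1 - a) * (-β * realFourier (A.γ 0).g ξ + α * realFourier (A.γ 1).g ξ))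
      (Q₂ := fun _ => 0)
      (D := α ^ 2 + β ^ 2) (by fun_prop) (by fun_prop) (by fun_prop) (by fun_prop) (fun ξ => ?_)
      (fun ξ => ?_) (fun ξ => ?_) (fun ξ => ?_) ?_ ?_
    · simp [hg ξ]
    · simp [hg ξ]
    · refine (hlin (-β * realFourier (A.γ 0).f ξ + α * realFourier (A.γ 1).f ξ) _).congr
        fun n => ?_
      have := hHC n
      push_cast
      field_simp
      ring
    · have := hinv.mul (hinv.mul_const
        (-β * realFourier (A.γ 0).g ξ + α * realFourier (A.γ 1).g ξ))
      simp only [zero_mul] at this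
      refine this.congr fun n => ?_
      push_cast
      ring
    · filter_upwards [hHinf.eventually_ge_atTop 1] with n hn
      have h1 : (H n)⁻¹ ≤ 1 := inv_le_one_of_one_le₀ hn
      have h0 : 0 < (H n)⁻¹ := inv_pos.2 (hH n)
      rw [show α * (α * (H n)⁻¹) - β * (-β * (H n)⁻¹) = (α ^ 2 + β ^ 2) * (H n)⁻¹ by ring,
        abs_of_nonneg (by positivity)]
      gcongr
      linarith
    · intro c d hcd hr
      have hr' : ∀ ξ, c * (α * realFourier (A.γ 0).f ξ + β * realFourier (A.γ 1).f ξ)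
          + d * ((1 - a) * (-β * realFourier (A.γ 0).g ξ + α * realFourier (A.γ 1).g ξ)) = 0 :=
        fun ξ => by
          refine (mul_eq_zero.1 (Eq.trans ?_ (hr ξ))).resolve_left hK
          ring
      by_cases hd : d = 0
      · have hc0 : (c : ℂ) ≠ 0 := by exact_mod_cast hcd.resolve_right (not_not.2 hd)
        refine hF fun ξ => (mul_eq_zero.1 (Eq.trans ?_ (hr' ξ))).resolve_left hc0
        rw [hd]
        push_cast
        ring
      · have hd' : (d : ℂ) ≠ 0 := by exact_mod_cast hd
        refine hc ⟨-(c / (d * (1 - a))), fun ξ => ?_⟩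
        push_cast
        field_simp
        linear_combination hr' ξ
  obtain ⟨c, hc⟩ := hc
  -- The growing part of the partner is proportional to the first observable. Subtracting `(1 - a) H
  -- c` times the latter is a shear, costs no determinant, and exposes the partner's `f`-part.
  by_cases hd : ∃ d : ℝ, ∀ ξ, -β * realFourier (A.γ 0).f ξ + α * realFourier (A.γ 1).f ξ
      = d * (α * realFourier (A.γ 0).f ξ + β * realFourier (A.γ 1).f ξ)
  swap
  · refine main (c₁₁ := fun _ => α) (c₁₂ := fun _ => β)
      (c₂₁ := fun n => -β - (1 - a) * H n * c * α) (c₂₂ := fun n => α - (1 - a) * H n * c * β)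
      (P₁ := fun ξ => α * realFourier (A.γ 0).f ξ + β * realFourier (A.γ 1).f ξ)
      (Q₁ := fun _ => 0)
      (P₂ := fun ξ => -β * realFourier (A.γ 0).f ξ + α * realFourier (A.γ 1).f ξ)
      (Q₂ := fun _ => 0)
      (D := α ^ 2 + β ^ 2) (by fun_prop) (by fun_prop) (by fun_prop) (by fun_prop) (fun ξ => ?_)
      (fun ξ => ?_) (fun ξ => ?_) (fun ξ => ?_) ?_ ?_
    · simp [hg ξ]
    · simp [hg ξ]
    · refine tendsto_const_nhds.congr fun n => ?_
      push_cast
      linear_combination -(1 - a) * H n * hc ξ + ((1 - a) * H n) ^ 2 * c * hg ξ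
    · have := hinv.mul_const (-β * realFourier (A.γ 0).g ξ + α * realFourier (A.γ 1).g ξ)
      rw [zero_mul] at this
      refine this.congr fun n => ?_
      push_cast
      linear_combination (H n : ℂ)⁻¹ * (1 - a) * H n * c * hg ξ
    · filter_upwards [abs_const_le_mul (show 0 ≤ α ^ 2 + β ^ 2 by positivity) hHinf] with n hn
      rw [show α * (α - (1 - a) * H n * c * β) - β * (-β - (1 - a) * H n * c * α)
        = α ^ 2 + β ^ 2 by ring, abs_of_nonneg (by positivity)]
      exact hn
    · intro c' d' hcd hr
      have hr' : ∀ ξ, c' * (α * realFourier (A.γ 0).f ξ + β * realFourier (A.γ 1).f ξ)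
          + d' * (-β * realFourier (A.γ 0).f ξ + α * realFourier (A.γ 1).f ξ) = 0 :=
        fun ξ => by
          refine (mul_eq_zero.1 (Eq.trans ?_ (hr ξ))).resolve_left hK
          ring
      by_cases hd0 : d' = 0
      · have hc0 : (c' : ℂ) ≠ 0 := by exact_mod_cast hcd.resolve_right (not_not.2 hd0)
        refine hF fun ξ => (mul_eq_zero.1 (Eq.trans ?_ (hr' ξ))).resolve_left hc0
        rw [hd0]
        push_cast
        ring
      · have hd' : (d' : ℂ) ≠ 0 := by exact_mod_cast hd0
        refine hd ⟨-(c' / d'), fun ξ => ?_⟩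
        push_cast
        field_simp
        linear_combination hr' ξ
  obtain ⟨d, hd⟩ := hd
  -- If `c = 0`, both `g` vanish while the two `f` are proportional, contradicting the canonical
  -- commutator.
  have hc0 : (c : ℂ) ≠ 0 := by
    intro h0
    have h : ∀ ξ, realFourier (A.γ 0).g ξ = 0 ∧ realFourier (A.γ 1).g ξ = 0 := fun ξ =>
      eq_zero_of_rotation hαβ (hg ξ) (by rw [hc ξ, h0, zero_mul])
    refine A.not_dependent_fourier (a := -β - d * α) (b := α - d * β) ?_ (fun ξ => ?_) fun ξ => ?_
    · by_contra! h1
      have h2 : α ^ 2 + β ^ 2 = 0 := by linear_combination α * h1.2 - β * h1.1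
      rcases hαβ with h3 | h3
      · have : 0 < α ^ 2 + β ^ 2 := by positivity
        linarith
      · have : 0 < α ^ 2 + β ^ 2 := by positivity
        linarith
    · rw [(h ξ).1, (h ξ).2, mul_zero, mul_zero, add_zero]
    · push_cast
      linear_combination hd ξ
  -- A further shear by `d` removes the partner's `f`-part too, leaving the term of order `k²/H`.
  -- Multiplying by `H` uses up the permitted determinant `D H`, and the limits are proportional to
  -- `F` and `k² F`, which are independent.
  refine main (c₁₁ := fun _ => α) (c₁₂ := fun _ => β)
    (c₂₁ := fun n => H n * (-β - ((1 - a) * H n * c + d) * α))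
    (c₂₂ := fun n => H n * (α - ((1 - a) * H n * c + d) * β))
    (P₁ := fun ξ => α * realFourier (A.γ 0).f ξ + β * realFourier (A.γ 1).f ξ)
    (Q₁ := fun _ => 0) (P₂ := fun _ => 0)
    (Q₂ := fun ξ => c * (α * realFourier (A.γ 0).f ξ + β * realFourier (A.γ 1).f ξ))
    (D := α ^ 2 + β ^ 2) (by fun_prop) (by fun_prop) (by fun_prop) (by fun_prop) (fun ξ => ?_)
    (fun ξ => ?_) (fun ξ => ?_) (fun ξ => ?_) ?_ ?_
  · simp [hg ξ]
  · simp [hg ξ]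
  · refine tendsto_const_nhds.congr fun n => ?_
    push_cast
    linear_combination -(H n : ℂ) * hd ξ - H n * (1 - a) * H n * hc ξ
      + H n * (1 - a) * H n * ((1 - a) * H n * c + d) * hg ξ
  · refine tendsto_const_nhds.congr fun n => ?_
    push_cast
    have := hHC n
    field_simp
    linear_combination -hc ξ + ((1 - a) * H n * c + d) * hg ξ
  · refine Eventually.of_forall fun n => le_of_eq ?_
    have := hH n
    rw [show α * (H n * (α - ((1 - a) * H n * c + d) * β))
      - β * (H n * (-β - ((1 - a) * H n * c + d) * α)) = (α ^ 2 + β ^ 2) * H n by ring,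
      abs_of_nonneg (by positivity)]
  · intro c' d' hcd hr
    refine hF (eq_zero_of_quadratic_mul (by fun_prop) (α := hankelKernel a 0 * c')
      (β := Complex.I * a * hankelKernel (a - 1) 0 * d' * c) ?_ fun ξ => ?_)
    · rcases hcd with h | h
      · exact Or.inl (mul_ne_zero hK (by exact_mod_cast h))
      · refine Or.inr (mul_ne_zero (mul_ne_zero (mul_ne_zero (mul_ne_zero Complex.I_ne_zero ?_)
          hK') (by exact_mod_cast h)) hc0)
        rw [Complex.ofReal_ne_zero]
        linarith
    · refine Eq.trans ?_ (hr ξ)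
      ring

/-! ### Joint limit of large Hubble rate and small mass. -/

/-- As `H → ∞` and `m → 0`, the determinant of every nonsaturating mode diverges. -/
theorem eventually_le_det_of_joint_limit {A : SingleMode} (hA : ¬ A.IsSaturating)
    {m H a : ℕ → ℝ} (hH : ∀ n, 0 < H n) (ha : ∀ n, bdIndex (m n) (H n) = a n + 1 / 2)
    (ha0 : ∀ n, 1 / 2 < a n) (ha1 : ∀ n, a n < 1) (hHinf : Tendsto H atTop atTop)
    (hlim : Tendsto a atTop (𝓝 1)) (hsq : Tendsto (fun n => (1 - a n) * H n ^ 2) atTop (𝓝 0))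
    (B : ℝ) :
    ∀ᶠ n in atTop, B ≤ (covariance (bunchDaviesMode (m n) (H n)) A).det := by
  have tf := fun i => (A.γ i).isTestFunction_f
  have tg := fun i => (A.γ i).isTestFunction_g
  have cf0 := (tf 0).continuous_realFourier
  have cf1 := (tf 1).continuous_realFourier
  have cg0 := (tg 0).continuous_realFourier
  have cg1 := (tg 1).continuous_realFourier
  have hHC : ∀ n, (H n : ℂ) ≠ 0 := fun n => by exact_mod_cast (hH n).ne'
  have hinvR : Tendsto (fun n => (H n)⁻¹) atTop (𝓝 0) := tendsto_inv_atTop_zero.comp hHinf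
  have toC : ∀ {u : ℕ → ℝ}, Tendsto u atTop (𝓝 0) →
      Tendsto (fun n => ((u n : ℝ) : ℂ)) atTop (𝓝 0) := by
    intro u hu
    have := (Complex.continuous_ofReal.tendsto 0).comp hu
    rwa [Complex.ofReal_zero] at this
  have hinv := toC hinvR
  have hsqC := toC hsq
  have h1R : Tendsto (fun n => (1 - a n) * H n) atTop (𝓝 0) := by
    have := hsq.mul hinvR
    rw [zero_mul] at this
    refine this.congr fun n => ?_
    have := (hH n).ne'
    field_simp
  have h1C := toC h1R
  have hlin : ∀ X Y : ℂ, Tendsto (fun n => Y + (((1 - a n) * H n : ℝ) : ℂ) * X) atTop (𝓝 Y) := by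
    intro X Y
    simpa using (h1C.mul_const X).const_add Y
  have hK : hankelKernel 1 0 = Complex.I := by simp [hankelKernel_one_left]
  have hK' : hankelKernel (1 - 1) 0 = 1 := by rw [sub_self, hankelKernel_zero_left]
  have main := fun {c₁₁ c₁₂ c₂₁ c₂₂ : ℕ → ℝ} {P₁ Q₁ P₂ Q₂ : Space → ℂ} h1 h2 h3 h4 h5 h6 h7 h8
      {D : ℝ} h9 h10 => eventually_le_det_of_limits (A := A) (c₁₁ := c₁₁) (c₁₂ := c₁₂)
    (c₂₁ := c₂₁) (c₂₂ := c₂₂) (P₁ := P₁) (Q₁ := Q₁) (P₂ := P₂) (Q₂ := Q₂) (D := D) (a₀ := 1) hH ha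
    ha0 ha1 (by norm_num) hlim hHinf h1 h2 h3 h4 h5 h6 h7 h8 h9 h10 B
  -- Since `(1 - a) H → 0`, the unscaled amplitudes see only the `f`-parts; if these are
  -- independent, nothing more is needed.
  by_cases hf : ∃ α β : ℝ, (α ≠ 0 ∨ β ≠ 0) ∧
      ∀ ξ, α * realFourier (A.γ 0).f ξ + β * realFourier (A.γ 1).f ξ = 0
  swap
  · refine main (c₁₁ := fun _ => 1) (c₁₂ := fun _ => 0) (c₂₁ := fun _ => 0) (c₂₂ := fun _ => 1)
      (P₁ := realFourier (A.γ 0).f) (Q₁ := fun _ => 0) (P₂ := realFourier (A.γ 1).f)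
      (Q₂ := fun _ => 0)
      (D := 1) (by fun_prop) (by fun_prop) (by fun_prop) (by fun_prop) (fun ξ => ?_) (fun ξ => ?_)
      (fun ξ => ?_) (fun ξ => ?_) ?_ ?_
    · refine (hlin (realFourier (A.γ 0).g ξ) _).congr fun n => ?_
      push_cast
      ring
    · simpa using hinv.mul_const (realFourier (A.γ 0).g ξ)
    · refine (hlin (realFourier (A.γ 1).g ξ) _).congr fun n => ?_
      push_cast
      ring
    · simpa using hinv.mul_const (realFourier (A.γ 1).g ξ)
    · filter_upwards [abs_const_le_mul zero_le_one hHinf] with n hn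
      simpa using hn
    · intro c d hcd hr
      refine hf ⟨c, d, hcd, fun ξ => ?_⟩
      have := hr ξ
      rw [hK] at this
      refine (mul_eq_zero.1 (Eq.trans ?_ this)).resolve_left Complex.I_ne_zero
      ring
  obtain ⟨α, β, hαβ, hf⟩ := hf
  have hG : ¬ ∀ ξ, α * realFourier (A.γ 0).g ξ + β * realFourier (A.γ 1).g ξ = 0 :=
    fun h => A.not_dependent_fourier hαβ h hf
  -- The pure momentum combination survives only at order `k²/H` and is multiplied by `H`. Its other
  -- term then becomes `(1 - a) H² G`, which is why `(1 - a) H² → 0` is assumed.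
  refine main (c₁₁ := fun n => H n * α) (c₁₂ := fun n => H n * β) (c₂₁ := fun _ => -β)
    (c₂₂ := fun _ => α) (P₁ := fun _ => 0)
    (Q₁ := fun ξ => α * realFourier (A.γ 0).g ξ + β * realFourier (A.γ 1).g ξ)
    (P₂ := fun ξ => -β * realFourier (A.γ 0).f ξ + α * realFourier (A.γ 1).f ξ)
    (Q₂ := fun _ => 0)
    (D := α ^ 2 + β ^ 2) (by fun_prop) (by fun_prop) (by fun_prop) (by fun_prop) (fun ξ => ?_)
    (fun ξ => ?_) (fun ξ => ?_) (fun ξ => ?_) ?_ ?_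
  · have := hsqC.mul_const (α * realFourier (A.γ 0).g ξ + β * realFourier (A.γ 1).g ξ)
    rw [zero_mul] at this
    refine this.congr fun n => ?_
    push_cast
    linear_combination -(H n : ℂ) * hf ξ
  · refine tendsto_const_nhds.congr fun n => ?_
    have := hHC n
    push_cast
    field_simp
  · refine (hlin (-β * realFourier (A.γ 0).g ξ + α * realFourier (A.γ 1).g ξ) _).congr fun n => ?_
    push_cast
    ring
  · simpa using hinv.mul_const (-β * realFourier (A.γ 0).g ξ + α * realFourier (A.γ 1).g ξ)
  · refine Eventually.of_forall fun n => le_of_eq ?_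
    have := hH n
    rw [show H n * α * α - H n * β * -β = (α ^ 2 + β ^ 2) * H n by ring,
      abs_of_nonneg (by positivity)]
  · intro c d hcd hr
    have hr' : ∀ ξ : Space, c * (((2 * Real.pi * ‖ξ‖) ^ 2 : ℝ)
        * (α * realFourier (A.γ 0).g ξ + β * realFourier (A.γ 1).g ξ))
        + d * (-β * realFourier (A.γ 0).f ξ + α * realFourier (A.γ 1).f ξ) = 0 := by
      intro ξ
      have := hr ξ
      rw [hK, hK'] at this
      refine (mul_eq_zero.1 (Eq.trans ?_ this)).resolve_left Complex.I_ne_zero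
      push_cast
      ring
    by_cases hd : d = 0
    · have hc : c ≠ 0 := hcd.resolve_right (not_not.2 hd)
      refine hG (eq_zero_of_quadratic_mul (by fun_prop) (α := 0) (β := c)
        (Or.inr (by exact_mod_cast hc)) fun ξ => ?_)
      have := hr' ξ
      rw [hd, Complex.ofReal_zero, zero_mul, add_zero] at this
      refine Eq.trans ?_ this
      ring
    -- Multiplication by `k²` is `-Δ`, so dependence of the limits makes the rotated `f`-part a
    -- multiple of `Δ g`. Rotating back yields the defining condition of a saturating mode.
    · set g := fun y => α * (A.γ 0).g y + β * (A.γ 1).g y with hgdef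
      have tg' : IsTestFunction g := (tg 0).linear (tg 1) α β
      have tf' := (tf 0).linear (tf 1) (-β) α
      have hrel : ∀ x, d * (-β * (A.γ 0).f x + α * (A.γ 1).f x)
          + -c * Laplacian.laplacian g x = 0 := by
        refine tf'.relation tg'.laplacian fun ξ => ?_
        rw [(tf 0).realFourier_linear (tf 1), tg'.realFourier_laplacian,
          (tg 0).realFourier_linear (tg 1)]
        push_cast
        have := hr' ξ
        push_cast at this
        linear_combination this
      have hn : α ^ 2 + β ^ 2 ≠ 0 := by
        rcases hαβ with h | h <;> positivity
      have hf0 := (tf 0).relation (tf 1) hf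
      refine hA ⟨α, β, hαβ, hf0, fun i => ?_⟩
      fin_cases i
      · refine ⟨-β * (c / d) / (α ^ 2 + β ^ 2), fun x => ?_⟩
        change (A.γ 0).f x = _ * Laplacian.laplacian g x
        field_simp
        linear_combination d * α * hf0 x - β * hrel x
      · refine ⟨α * (c / d) / (α ^ 2 + β ^ 2), fun x => ?_⟩
        change (A.γ 1).f x = _ * Laplacian.laplacian g x
        field_simp
        linear_combination d * β * hf0 x + α * hrel x

/-! ### Saturating modes at fixed Hubble rate. -/

theorem amplitude_minkowski {γ : PhasePoint} (ξ : Space) :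
    amplitude minkowskiMode γ ξ = ((Real.sqrt (2 * (2 * Real.pi * ‖ξ‖)))⁻¹ : ℝ)
      * (realFourier γ.f ξ + Complex.I * (2 * Real.pi * ‖ξ‖ : ℝ) * realFourier γ.g ξ) := by
  rw [amplitude_eq, minkowskiMode_zero, deriv_minkowskiMode]
  ring

theorem rpow_neg_three_halves_div {k : ℝ} (hk : 0 < k) :
    k ^ (-((1 : ℝ) + 1 / 2)) / (Real.sqrt 2 * Real.Gamma (1 + 1)) = (Real.sqrt (2 * k))⁻¹ / k := by
  rw [show (1 : ℝ) + 1 = 2 by norm_num, Real.Gamma_two, neg_add, Real.rpow_add hk,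
    Real.rpow_neg_one, Real.rpow_neg hk.le, ← Real.sqrt_eq_rpow, Real.sqrt_mul (by norm_num)]
  field_simp

/-- At fixed `H`, the small-mass limit of the determinant of a saturating mode is at least its
Minkowski value. -/
theorem SingleMode.IsSaturating.eventually_lt_det {A : SingleMode} (hA : A.IsSaturating) {m a : ℕ → ℝ}
    {H : ℝ} (hH : 0 < H) (ha : ∀ n, bdIndex (m n) H = a n + 1 / 2) (ha0 : ∀ n, 1 / 2 < a n)
    (ha1 : ∀ n, a n < 1) (hlim : Tendsto a atTop (𝓝 1)) {t : ℝ} (ht0 : 0 ≤ t)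
    (ht : t < (covariance minkowskiMode A).det) :
    ∀ᶠ n in atTop, t < (covariance (bunchDaviesMode (m n) H) A).det := by
  obtain ⟨α, β, hαβ, hf, hl⟩ := hA
  choose l hl using hl
  have tf := fun i => (A.γ i).isTestFunction_f
  have tg := fun i => (A.γ i).isTestFunction_g
  set D := α ^ 2 + β ^ 2 with hD
  have hDpos : 0 < D := by rcases hαβ with h | h <;> positivity
  -- The outer sign compensates the symbol `-k²` of the Laplacian.
  obtain ⟨c, hcl⟩ : ∃ c : ℝ, c = -(-β * l 0 + α * l 1) := ⟨_, rfl⟩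
  have hfF : ∀ ξ, α * realFourier (A.γ 0).f ξ + β * realFourier (A.γ 1).f ξ = 0 := by
    intro ξ
    rw [← (tf 0).realFourier_linear (tf 1), funext hf]
    simp [realFourier, Real.fourier_eq]
  have hF2 : ∀ ξ, -β * realFourier (A.γ 0).f ξ + α * realFourier (A.γ 1).f ξ
      = c * ((2 * Real.pi * ‖ξ‖) ^ 2 : ℝ)
        * (α * realFourier (A.γ 0).g ξ + β * realFourier (A.γ 1).g ξ) := by
    intro ξ
    have tg' := (tg 0).linear (tg 1) α β
    have e : ∀ i, realFourier (A.γ i).f ξ = l i * (-((2 * Real.pi * ‖ξ‖) ^ 2 : ℝ)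
        * (α * realFourier (A.γ 0).g ξ + β * realFourier (A.γ 1).g ξ)) := by
      intro i
      rw [← (tg 0).realFourier_linear (tg 1), ← tg'.realFourier_laplacian]
      have := tg'.laplacian.realFourier_linear tg'.laplacian (l i) 0 ξ
      rw [Complex.ofReal_zero, zero_mul, add_zero] at this
      rw [← this]
      congr 1
      funext x
      rw [hl i x, zero_mul, add_zero]
    rw [e 0, e 1, hcl]
    push_cast
    ring
  set V₁ : Space → ℂ := fun ξ => α * amplitude minkowskiMode (A.γ 0) ξ
    + β * amplitude minkowskiMode (A.γ 1) ξ
  -- This is the rotated Minkowski partner plus `H c` times `V₁`. The change of basis still has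
  -- determinant `α² + β²`.
  set V₂ : Space → ℂ := fun ξ => ((-β + H * c * α : ℝ) : ℂ) * amplitude minkowskiMode (A.γ 0) ξ
    + ((α + H * c * β : ℝ) : ℂ) * amplitude minkowskiMode (A.γ 1) ξ
  have hV : gramIntegral volume V₁ V₂ = ENNReal.ofReal (D ^ 2)
      * gramIntegral volume (amplitude minkowskiMode (A.γ 0)) (amplitude minkowskiMode (A.γ 1)) := by
    rw [gramIntegral_linear]
    congr 2
    rw [hD]
    ring
  have hM := ofReal_det_covariance (u := minkowskiMode) (A := A) fun i => memLp_minkowski _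
  have hV' : 2 * gramIntegral volume V₁ V₂
      = ENNReal.ofReal (D ^ 2 * (covariance minkowskiMode A).det) := by
    rw [hV, ENNReal.ofReal_mul (sq_nonneg D), hM]
    ring
  have hc : ENNReal.ofReal (D ^ 2 / 2 * t) < gramIntegral volume V₁ V₂ := by
    have h3 : (2 : ENNReal) * ENNReal.ofReal (D ^ 2 / 2 * t) < 2 * gramIntegral volume V₁ V₂ := by
      have e2 : (2 : ENNReal) * ENNReal.ofReal (D ^ 2 / 2 * t) = ENNReal.ofReal (D ^ 2 * t) := by
        rw [show D ^ 2 * t = 2 * (D ^ 2 / 2 * t) by ring,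
          ENNReal.ofReal_mul (p := 2) (by norm_num), ENNReal.ofReal_ofNat]
      rw [e2, hV', ENNReal.ofReal_lt_ofReal_iff_of_nonneg (by positivity)]
      exact mul_lt_mul_of_pos_left ht (by positivity)
    exact lt_of_mul_lt_mul_left' h3
  have haR : Tendsto (fun n => H ^ a n) atTop (𝓝 H) := by
    have := tendsto_const_nhds (x := H) |>.rpow hlim (Or.inl hH.ne')
    rwa [Real.rpow_one] at this
  have haC : Tendsto (fun n => ((H ^ a n : ℝ) : ℂ)) atTop (𝓝 (H : ℂ)) :=
    (Complex.continuous_ofReal.tendsto _).comp haR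
  have h1C : Tendsto (fun n => (((1 - a n) * H : ℝ) : ℂ)) atTop (𝓝 0) := by
    have h := (Complex.continuous_ofReal.tendsto _).comp ((hlim.const_sub 1).mul_const H)
    simp only [sub_self, zero_mul, Complex.ofReal_zero] at h
    exact h
  have hHC : (H : ℂ) ≠ 0 := by exact_mod_cast hH.ne'
  -- At `a = 1` the kernels are elementary, `K₁(x) = x + i` and `K₀ = 1`. The limit is the Minkowski
  -- amplitude with an extra factor `1 + iH/k` on the field part.
  have lim : ∀ (p q : ℝ) (ξ : Space), ξ ≠ 0 →
      Tendsto (fun n => ((p * H ^ a n : ℝ) : ℂ) * modeAmplitude (a n) H (A.γ 0) ξ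
        + ((q * H ^ a n : ℝ) : ℂ) * modeAmplitude (a n) H (A.γ 1) ξ) atTop
      (𝓝 (((Real.sqrt (2 * (2 * Real.pi * ‖ξ‖)))⁻¹ : ℝ)
        * ((1 + Complex.I * H / (2 * Real.pi * ‖ξ‖ : ℝ))
          * (p * realFourier (A.γ 0).f ξ + q * realFourier (A.γ 1).f ξ)
        + Complex.I * (2 * Real.pi * ‖ξ‖ : ℝ)
          * (p * realFourier (A.γ 0).g ξ + q * realFourier (A.γ 1).g ξ)))) := by
    intro p q ξ hξ
    have hk := two_pi_norm_pos hξ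
    set k := 2 * Real.pi * ‖ξ‖
    set F := p * realFourier (A.γ 0).f ξ + q * realFourier (A.γ 1).f ξ
    set G := p * realFourier (A.γ 0).g ξ + q * realFourier (A.γ 1).g ξ
    have hP : Tendsto (fun n => ((H ^ a n : ℝ) : ℂ) * F
        + (((1 - a n) * H : ℝ) : ℂ) * (((H ^ a n : ℝ) : ℂ) * G)) atTop (𝓝 (H * F)) := by
      simpa using (haC.mul_const F).add (h1C.mul (haC.mul_const G))
    have hQ : Tendsto (fun n => ((H⁻¹ : ℝ) : ℂ) * (((H ^ a n : ℝ) : ℂ) * G)) atTop (𝓝 G) := by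
      have := (haC.mul_const G).const_mul ((H⁻¹ : ℝ) : ℂ)
      rwa [Complex.ofReal_inv, inv_mul_cancel_left₀ hHC, ← Complex.ofReal_inv] at this
    have h := tendsto_reducedAmplitude hk (fun _ => hH) (by norm_num) hlim ha1 tendsto_const_nhds
      hP hQ
    have e : (((k ^ (-((1 : ℝ) + 1 / 2)) / (Real.sqrt 2 * Real.Gamma (1 + 1)) : ℝ) : ℂ)
        * (hankelKernel 1 (k / H) * (H * F)
          + Complex.I * (1 : ℝ) * (k ^ 2 : ℝ) * hankelKernel (1 - 1) (k / H) * G))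
        = ((Real.sqrt (2 * k))⁻¹ : ℝ) * ((1 + Complex.I * H / (k : ℝ)) * F
          + Complex.I * (k : ℝ) * G) := by
      have hkC : (k : ℂ) ≠ 0 := by exact_mod_cast hk.ne'
      rw [rpow_neg_three_halves_div hk, hankelKernel_one_left, sub_self, hankelKernel_zero_left]
      push_cast
      field_simp
    rw [e] at h
    refine h.congr fun n => ?_
    rw [modeAmplitude, modeAmplitude, reducedAmplitude_linear]
    congr 1 <;> push_cast <;> ring
  have h₁ : ∀ ξ, ξ ≠ 0 → Tendsto (fun n => ((α * H ^ a n : ℝ) : ℂ) * modeAmplitude (a n) H (A.γ 0) ξ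
      + ((β * H ^ a n : ℝ) : ℂ) * modeAmplitude (a n) H (A.γ 1) ξ) atTop (𝓝 (V₁ ξ)) := by
    intro ξ hξ
    have h := lim α β ξ hξ
    rw [hfF] at h
    refine h.trans_eq (congrArg 𝓝 ?_)
    simp only [V₁, amplitude_minkowski]
    linear_combination -(((Real.sqrt (2 * (2 * Real.pi * ‖ξ‖)))⁻¹ : ℝ) : ℂ) * hfF ξ
  have h₂ : ∀ ξ, ξ ≠ 0 → Tendsto (fun n => ((-β * H ^ a n : ℝ) : ℂ) * modeAmplitude (a n) H (A.γ 0) ξ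
      + ((α * H ^ a n : ℝ) : ℂ) * modeAmplitude (a n) H (A.γ 1) ξ) atTop (𝓝 (V₂ ξ)) := by
    intro ξ hξ
    have h := lim (-β) α ξ hξ
    refine h.trans_eq (congrArg 𝓝 ?_)
    have hkC : ((2 * Real.pi * ‖ξ‖ : ℝ) : ℂ) ≠ 0 := by exact_mod_cast (two_pi_norm_pos hξ).ne'
    -- Saturation turns the infrared term `(iH/k) F` into `H c · i k G`, which is `H c` times the
    -- Minkowski amplitude of the pure momentum combination.
    have h3 : Complex.I * H / (2 * Real.pi * ‖ξ‖ : ℝ)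
        * (-β * realFourier (A.γ 0).f ξ + α * realFourier (A.γ 1).f ξ)
        = Complex.I * H * c * (2 * Real.pi * ‖ξ‖ : ℝ)
          * (α * realFourier (A.γ 0).g ξ + β * realFourier (A.γ 1).g ξ) := by
      rw [hF2 ξ, Complex.ofReal_pow]
      field_simp
    simp only [V₂, amplitude_minkowski]
    rw [Complex.ofReal_neg]
    generalize (((Real.sqrt (2 * (2 * Real.pi * ‖ξ‖)))⁻¹ : ℝ) : ℂ) = S
    generalize ((2 * Real.pi * ‖ξ‖ : ℝ) : ℂ) = k at *
    have h4 := hfF ξ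
    push_cast
    linear_combination S * h3 - S * H * c * h4
  filter_upwards [LocalModes.eventually_lt_det (fun _ => hH) ha ha0 ha1 h₁ h₂ hc] with n hn
  have e : (α * H ^ a n * (α * H ^ a n) - β * H ^ a n * (-β * H ^ a n)) ^ 2 / (2 * H ^ (4 * a n))
      = D ^ 2 / 2 := by
    have : H ^ (4 * a n) = (H ^ a n) ^ 4 := by
      rw [← Real.rpow_natCast, ← Real.rpow_mul hH.le]
      push_cast
      ring_nf
    rw [this, hD]
    have := Real.rpow_pos_of_pos hH (a n)
    field_simp
    ring
  rw [e] at hn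
  exact lt_of_mul_lt_mul_left hn (by positivity)

/-! ### From determinants to entropies. -/

theorem bdIndex_sub_half {m H : ℝ} : bdIndex m H = (bdIndex m H - 1 / 2) + 1 / 2 := by ring

/-- If every threshold failed, there would be counterexamples with `R H ≥ n + 1`. As `R` is fixed,
this forces `R > 0` and `H → ∞`, against the divergence of the determinant. -/
theorem entropy_fixed_ratio {κ : ℝ} (hκ : 0 < κ) (hκ1 : κ < 1) (A : SingleMode) :
    ∃ L : ℝ, ∀ H m : ℝ, 0 < H → m / H = κ → L ≤ A.radius * H →
      minkowskiEntropy A ≤ bunchDaviesEntropy m H A := by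
  by_contra! hcon
  choose H m hH hm hL hlt using fun n : ℕ => hcon (n + 1)
  have hR : 0 < A.radius := by
    have := hL 0
    have h0 := hH 0
    rw [Nat.cast_zero, zero_add] at this
    exact (mul_pos_iff_of_pos_right h0).1 (by linarith)
  have hHinf : Tendsto H atTop atTop := by
    refine tendsto_atTop_mono (f := fun n : ℕ => (n : ℝ) / A.radius) (fun n => ?_)
      (tendsto_natCast_atTop_atTop.atTop_div_const hR)
    rw [div_le_iff₀ hR]
    linarith [hL n]
  have hm0 : ∀ n, 0 < m n := fun n => by
    have := (div_eq_iff (hH n).ne').1 (hm n)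
    rw [this]
    exact mul_pos hκ (hH n)
  have hi : ∀ n, bdIndex (m n) (H n) = (Real.sqrt (9 / 4 - κ ^ 2) - 1 / 2) + 1 / 2 := fun n => by
    rw [bdIndex_eq, hm n]
    ring
  have hb := bdIndex_bounds (hm0 0) (hH 0) (by rw [hm]; exact hκ1)
  rw [hi 0] at hb
  obtain ⟨n, hn⟩ := (eventually_le_det_of_fixed_index A hH hi (by linarith [hb.1])
    (by linarith [hb.2]) hHinf (covariance minkowskiMode A).det).exists
  exact absurd (entropy_le_entropy hn) (not_le.2 (hlt n))

theorem entropy_joint_limit {A : SingleMode} (hA : ¬ A.IsSaturating) :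
    ∃ L ε : ℝ, 0 < ε ∧ ∀ H m : ℝ, 0 < H → 0 < m → L ≤ A.radius * H → m * A.radius ≤ ε →
      minkowskiEntropy A ≤ bunchDaviesEntropy m H A := by
  by_contra! hcon
  choose H m hH hm hL hε hlt using fun n : ℕ => hcon (n + 1) (1 / ((n : ℝ) + 2)) (by positivity)
  have hR : 0 < A.radius := by
    have := hL 0
    have h0 := hH 0
    rw [Nat.cast_zero, zero_add] at this
    exact (mul_pos_iff_of_pos_right h0).1 (by linarith)
  have hHinf : Tendsto H atTop atTop := by
    refine tendsto_atTop_mono (f := fun n : ℕ => (n : ℝ) / A.radius) (fun n => ?_)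
      (tendsto_natCast_atTop_atTop.atTop_div_const hR)
    rw [div_le_iff₀ hR]
    linarith [hL n]
  have hmt : Tendsto m atTop (𝓝 0) := by
    have h1 : Tendsto (fun n : ℕ => 1 / ((n : ℝ) + 1) / A.radius) atTop (𝓝 0) := by
      simpa using tendsto_one_div_add_atTop_nhds_zero_nat.div_const A.radius
    refine squeeze_zero (fun n => (hm n).le) (fun n => ?_) h1
    rw [le_div_iff₀ hR]
    refine (hε n).trans ?_
    gcongr
    norm_num
  have hr : ∀ n, m n / H n < 1 := by
    intro n
    rw [div_lt_one (hH n)]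
    have h1 : 1 / ((n : ℝ) + 2) < 1 := by
      rw [div_lt_one (by positivity)]
      have : (0 : ℝ) ≤ n := n.cast_nonneg
      linarith
    have h2 : m n * A.radius < H n * A.radius := by
      have : (0 : ℝ) ≤ n := n.cast_nonneg
      linarith [hε n, hL n]
    exact lt_of_mul_lt_mul_right h2 hR.le
  have hb := fun n => bdIndex_bounds (hm n) (hH n) (hr n)
  -- From `1 - a ≤ m²/H²` the expression is at most `m²`.
  have hsq : Tendsto (fun n => (1 - (bdIndex (m n) (H n) - 1 / 2)) * H n ^ 2) atTop (𝓝 0) := by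
    refine squeeze_zero (fun n => mul_nonneg (by linarith [(hb n).2]) (sq_nonneg _)) (fun n => ?_)
      (by simpa using hmt.pow 2)
    have h1 := three_halves_sub_bdIndex_le (hm n) (hH n) (hr n)
    rw [div_pow, le_div_iff₀ (pow_pos (hH n) 2)] at h1
    linarith
  have hlim : Tendsto (fun n => bdIndex (m n) (H n) - 1 / 2) atTop (𝓝 1) := by
    have h1 := (hsq.mul ((tendsto_inv_atTop_zero.comp hHinf).pow 2)).const_sub 1
    rw [zero_mul, sub_zero] at h1
    refine h1.congr fun n => ?_
    have := (hH n).ne'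
    simp only [Function.comp]
    field_simp
    ring
  obtain ⟨n, hn⟩ := (eventually_le_det_of_joint_limit hA hH (fun n => bdIndex_sub_half)
    (fun n => by linarith [(hb n).1]) (fun n => by linarith [(hb n).2]) hHinf hlim hsq
    (covariance minkowskiMode A).det).exists
  exact absurd (entropy_le_entropy hn) (not_le.2 (hlt n))

theorem entropy_saturating {A : SingleMode} (hA : A.IsSaturating) {H δ : ℝ} (hH : 0 < H)
    (hδ : 0 < δ) :
    ∃ ε : ℝ, 0 < ε ∧ ∀ m : ℝ, 0 < m → m / H ≤ ε →
      minkowskiEntropy A - δ ≤ bunchDaviesEntropy m H A := by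
  by_contra! hcon
  choose m hm hε hlt using fun n : ℕ => hcon (1 / ((n : ℝ) + 2)) (by positivity)
  have hr : ∀ n, m n / H < 1 := by
    intro n
    refine (hε n).trans_lt ?_
    rw [div_lt_one (by positivity)]
    have : (0 : ℝ) ≤ n := n.cast_nonneg
    linarith
  have hmt : Tendsto (fun n => m n / H) atTop (𝓝 0) := by
    refine squeeze_zero (fun n => (div_pos (hm n) hH).le) (fun n => ?_)
      tendsto_one_div_add_atTop_nhds_zero_nat
    refine (hε n).trans ?_
    gcongr
    norm_num
  have hb := fun n => bdIndex_bounds (hm n) hH (hr n)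
  have hlim : Tendsto (fun n => bdIndex (m n) H - 1 / 2) atTop (𝓝 1) := by
    have h1 : Tendsto (fun n => 3 / 2 - bdIndex (m n) H) atTop (𝓝 0) :=
      squeeze_zero (fun n => by linarith [(hb n).2])
        (fun n => three_halves_sub_bdIndex_le (hm n) hH (hr n)) (by simpa using hmt.pow 2)
    have h2 := h1.const_sub 1
    rw [sub_zero] at h2
    exact h2.congr fun n => by ring
  set d := (covariance minkowskiMode A).det with hd
  have hE : ∀ m, bunchDaviesEntropy m H A
      = gaussianEntropy (Real.sqrt (covariance (bunchDaviesMode m H) A).det) := fun m => rfl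
  have hE0 : minkowskiEntropy A = gaussianEntropy (Real.sqrt d) := rfl
  -- A nonpositive `d` would give the square root `0`, where the entropy function is least on `[0,
  -- ∞)`, so positivity of `d` need not be proved.
  rcases le_or_gt d 0 with h0 | h0
  · have h1 : minkowskiEntropy A ≤ bunchDaviesEntropy (m 0) H A := by
      rw [hE, hE0, Real.sqrt_eq_zero_of_nonpos h0]
      exact monotoneOn_gaussianEntropy self_mem_Ici (Real.sqrt_nonneg _) (Real.sqrt_nonneg _)
    linarith [hlt 0]
  · have hc : ContinuousAt (fun t => gaussianEntropy (Real.sqrt t)) d :=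
      (continuous_gaussianEntropy.comp Real.continuous_sqrt).continuousAt
    -- Semicontinuity reaches only determinants strictly below `d`; continuity of the entropy
    -- absorbs the gap into `δ`.
    have h1 : ∀ᶠ t in 𝓝[<] d, gaussianEntropy (Real.sqrt d) - δ < gaussianEntropy (Real.sqrt t) :=
      nhdsWithin_le_nhds (hc.eventually (lt_mem_nhds (by linarith)))
    obtain ⟨t, ht1, ht2⟩ := (h1.and (Ioo_mem_nhdsLT h0)).exists
    obtain ⟨n, hn⟩ := (hA.eventually_lt_det hH (fun n => bdIndex_sub_half)
      (fun n => by linarith [(hb n).1]) (fun n => by linarith [(hb n).2]) hlim ht2.1.le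
      ht2.2).exists
    have h2 := monotoneOn_gaussianEntropy (Real.sqrt_nonneg _) (Real.sqrt_nonneg _)
      (Real.sqrt_le_sqrt hn.le)
    rw [← hE] at h2
    linarith [hlt n]

end

end LocalModes


/-- Entropy of a localized mode: Bunch-Davies versus Minkowski vacuum.  The three clauses are:
fixed small `m/H` and `RH` large, for every mode; `RH` large and `mR` small jointly, for every
nonsaturating mode; the small-mass limit at fixed large `RH`, for every mode. -/
theorem proposition1 :
    (∃ ε : ℝ, 0 < ε ∧ ∀ κ : ℝ, 0 < κ → κ < ε → ∀ A : LocalModes.SingleMode,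
      ∃ L : ℝ, ∀ H m : ℝ, 0 < H → m / H = κ → L ≤ A.radius * H →
        LocalModes.minkowskiEntropy A ≤ LocalModes.bunchDaviesEntropy m H A) ∧
    (∀ A : LocalModes.SingleMode, ¬ A.IsSaturating →
      ∃ L ε : ℝ, 0 < ε ∧ ∀ H m : ℝ, 0 < H → 0 < m → L ≤ A.radius * H → m * A.radius ≤ ε →
        LocalModes.minkowskiEntropy A ≤ LocalModes.bunchDaviesEntropy m H A) ∧
    (∀ A : LocalModes.SingleMode,
      ∃ L : ℝ, ∀ H : ℝ, 0 < H → L ≤ A.radius * H → ∀ δ : ℝ, 0 < δ →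
        ∃ ε : ℝ, 0 < ε ∧ ∀ m : ℝ, 0 < m → m / H ≤ ε →
          LocalModes.minkowskiEntropy A - δ ≤ LocalModes.bunchDaviesEntropy m H A) := by
  -- For every ratio below `1` the index lies in `(1, 3/2)`, so `1/2 < a < 1`.
  refine ⟨⟨1, one_pos, fun κ h0 h1 A => LocalModes.entropy_fixed_ratio h0 h1 A⟩,
    fun A hA => LocalModes.entropy_joint_limit hA, fun A => ?_⟩
  by_cases hA : A.IsSaturating
  · exact ⟨0, fun H hH _ δ hδ => LocalModes.entropy_saturating hA hH hδ⟩
  · obtain ⟨L, ε, hε, h⟩ := LocalModes.entropy_joint_limit hA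
    -- The `1` makes `R H` positive, and `m/H ≤ ε/(R H)` is the same as `m R ≤ ε`.
    refine ⟨max L 1, fun H hH hL δ hδ => ⟨ε / (A.radius * H), ?_, fun m hm hmH => ?_⟩⟩
    · have := (le_max_right L 1).trans hL
      positivity
    · have hRH : 0 < A.radius * H := by linarith [(le_max_right L 1).trans hL]
      have h1 : m * A.radius ≤ ε := by
        rw [div_le_div_iff₀ hH hRH] at hmH
        refine le_of_mul_le_mul_right ?_ hH
        linarith
      linarith [h H m hH hm ((le_max_left L 1).trans hL) h1]
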